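/- Let $d\ge 1$, $\delta>0$ and $1\le p<\infty$. For a Schwartz function $f$ on $\mathbb{R}^d$ write $\hat f(\xi)=\int_{\mathbb{R}^d} f(x)e^{-ix\cdot\xi}\,dx$, and let the Bochner–Riesz mean $B_\delta f$ be the function with $\widehat{B_\delta f}(\xi)=(1-|\xi|^2)_+^{\delta}\,\hat f(\xi)$, where $t_+=\max(t,0)$. Let $w$ be a Muckenhoupt $A_p$-weight on $\mathbb{R}^d$, i.e. a measurable, almost everywhere positive function for which there is a finite constant $C$ such that for all cubes $Q\subset\mathbb{R}^d$ $$\Big(\frac1{|Q|}\int_Q w\,dx\Big)\Big(\frac1{|Q|}\int_Q w^{-1/(p-1)}\,dx\Big)^{p-1}\le C \quad\text{if } 1<p<\infty,$$ $$\frac1{|Q|}\int_Q w\,dx\le C\operatorname*{ess\,inf}_{x\in Q} w(x)\quad\text{if } p=1.$$ Let $L^p_w$ be the Banach space of (classes of) measurable functions $f:\mathbb{R}^d\to\mathbb{C}$ with $\|f\|_{p,w}=\big(\int_{\mathbb{R}^d}|f(x)|^p w(x)\,dx\big)^{1/p}<\infty$. Suppose that $B_\delta$ is bounded on $L^p_w$,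 i.e. there is a finite constant $C'$ with $\|B_\delta f\|_{p,w}\le C'\|f\|_{p,w}$ for all Schwartz functions $f$. Then $B_\delta$ maps Schwartz functions, all of which lie in $L^p_w$, into $L^p_w$ and extends uniquely to a bounded linear operator on $L^p_w$, and the spectrum of this extension, i.e. the set of all $z\in\mathbb{C}$ for which $zI-B_\delta$ has no bounded inverse on $L^p_w$, is exactly the unit interval $[0,1]$. -/

import Mathlib

open MeasureTheory Real FourierTransform
open scoped ENNReal NNReal SchwartzMap

/-- The closed cube in `ℝ^d` with lower corner `a` and side length `l`. -/
def cube {d : ℕ} (a : EuclideanSpace ℝ (Fin d)) (l : ℝ) : Set (EuclideanSpace ℝ (Fin d)) :=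
  {x | ∀ i, x i ∈ Set.Icc (a i) (a i + l)}

/-- The average `|Q|⁻¹ ∫_Q g(x) dx` of a `[0, ∞]`-valued function. -/
noncomputable def cubeAverage {d : ℕ} (Q : Set (EuclideanSpace ℝ (Fin d)))
    (g : EuclideanSpace ℝ (Fin d) → ℝ≥0∞) : ℝ≥0∞ :=
  (∫⁻ x in Q, g x) / volume Q

/-- `w` is a Muckenhoupt `A_p`-weight on `ℝ^d`, `1 ≤ p < ∞`. The averages take values in `[0, ∞]`,
so the bounds contain the local integrability of `w` (and of `w ^ (-1 / (p - 1))` if `1 < p`). -/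
structure IsMuckenhoupt {d : ℕ} (p : ℝ≥0∞) (w : EuclideanSpace ℝ (Fin d) → ℝ) : Prop where
  aemeasurable : AEMeasurable w
  pos : ∀ᵐ x, 0 < w x
  bound_of_one_lt : 1 < p → ∃ C : ℝ≥0, ∀ (a : EuclideanSpace ℝ (Fin d)) (l : ℝ), 0 < l →
    cubeAverage (cube a l) (fun x => ENNReal.ofReal (w x)) *
      cubeAverage (cube a l) (fun x => ENNReal.ofReal (w x) ^ (-1 / (p.toReal - 1))) ^
        (p.toReal - 1) ≤ C
  bound_of_eq_one : p = 1 → ∃ C : ℝ≥0, ∀ (a : EuclideanSpace ℝ (Fin d)) (l : ℝ), 0 < l →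
    cubeAverage (cube a l) (fun x => ENNReal.ofReal (w x)) ≤
      C * essInf (fun x => ENNReal.ofReal (w x)) (volume.restrict (cube a l))

/-- The measure `w(x) dx`. -/
noncomputable def weightMeasure {d : ℕ} (w : EuclideanSpace ℝ (Fin d) → ℝ) :
    Measure (EuclideanSpace ℝ (Fin d)) :=
  volume.withDensity (fun x => ENNReal.ofReal (w x))

/-- The weighted space `L^p_w` of complex-valued functions on `ℝ^d`, with norm
`(∫ |f(x)|^p w(x) dx)^(1/p)`. -/
noncomputable abbrev WeightedLp {d : ℕ} (p : ℝ≥0∞) (w : EuclideanSpace ℝ (Fin d) → ℝ) :=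
  Lp ℂ p (weightMeasure w)

/-- The Bochner-Riesz symbol `(1 - |ξ|²)_+ ^ δ`. -/
noncomputable def bochnerRieszSymbol {d : ℕ} (δ : ℝ) (ξ : EuclideanSpace ℝ (Fin d)) : ℝ :=
  max (1 - ‖ξ‖ ^ 2) 0 ^ δ

/-- The Bochner-Riesz mean of a Schwartz function: the multiplier operator with symbol
`(1 - |ξ|²)_+ ^ δ` with respect to the Fourier transform `f̂(ξ) = ∫ f(x) exp(-i x·ξ) dx`.
Mathlib's transform `𝓕` has kernel `exp(-2π i x·ξ)`, i.e. `𝓕 f ξ = f̂(2π ξ)`, which is why the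
symbol is evaluated at `2π ξ`. -/
noncomputable def bochnerRiesz {d : ℕ} (δ : ℝ) (f : 𝓢(EuclideanSpace ℝ (Fin d), ℂ)) :
    EuclideanSpace ℝ (Fin d) → ℂ :=
  𝓕⁻ (fun ξ : EuclideanSpace ℝ (Fin d) =>
    (bochnerRieszSymbol δ ((2 * π) • ξ) : ℂ) * 𝓕 (f : EuclideanSpace ℝ (Fin d) → ℂ) ξ)

/-- `B_δ` is bounded on `L^p_w`: the a priori bound `‖B_δ f‖_{p,w} ≤ C ‖f‖_{p,w}` holds on the
Schwartz class. -/
def BochnerRieszBounded {d : ℕ} (δ : ℝ) (p : ℝ≥0∞) (w : EuclideanSpace ℝ (Fin d) → ℝ) : Prop :=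
  ∃ C : ℝ≥0, ∀ f : 𝓢(EuclideanSpace ℝ (Fin d), ℂ),
    eLpNorm (bochnerRiesz δ f) p (weightMeasure w) ≤ C * eLpNorm f p (weightMeasure w)

/-- The bounded operator `T` on `L^p_w` is (the extension of) `B_δ`: Schwartz functions and their
Bochner-Riesz means are in `L^p_w`, and `T f = B_δ f` for every Schwartz function `f`. -/
def IsBochnerRieszOn {d : ℕ} (δ : ℝ) (p : ℝ≥0∞) [Fact (1 ≤ p)]
    (w : EuclideanSpace ℝ (Fin d) → ℝ) (T : WeightedLp p w →L[ℂ] WeightedLp p w) : Prop :=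
  ∀ f : 𝓢(EuclideanSpace ℝ (Fin d), ℂ),
    ∃ (hf : MemLp f p (weightMeasure w)) (hBf : MemLp (bochnerRiesz δ f) p (weightMeasure w)),
      T (hf.toLp f) = hBf.toLp (bochnerRiesz δ f)

/-! Write $a$ for the symbol, rescaled to Mathlib's Fourier transform. Only one class of multipliers
has to be constructed: every compactly supported symbol of class $C^N$, $N=2d+4$, is bounded on
$L^p_w$ (`CubeAveragesBounded.hasSmoothMultipliers`). Its kernel decays like $(1+|x|)^{-N}$, hence
is dominated by a convergent sum of cube averages, and the $A_p$ condition bounds those.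

Upper inclusion: if $b\in C^N_c$ avoids $z\ne0$, then $(z-b)^{-1}-z^{-1}$ is again in $C^N_c$, so
$z$ is in the resolvent set of the multiplier $b$ (`IsMultiplier.notMem_spectrum`). The symbol $a$
need not be $C^N$, but $a^k$ is once $k\delta>N$. So $z\in\sigma(T)$ forces $z^k\in[0,1]$ for all
large $k$, and two consecutive powers give $z\in[0,1]$ (`IsMultiplier.spectrum_subset`).

Lower inclusion: let $z=a(\xi_0)$ with $a$ smooth near $\xi_0$, and suppose $R=(z-T)^{-1}$ exists.
For a cutoff $\chi$ near $\xi_0$ the symbol $(z-a)\chi$ is smooth and at most $\eta$ in absolute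
value, so by the resolvent lemma its operator has spectral radius at most $\eta$. High powers of it,
composed with powers of $R$, still fix functions with frequencies where $\chi=1$, which is
impossible for small $\eta$ (`IsMultiplier.mem_spectrum`). This gives $(0,1)$; the endpoints follow
because the spectrum is closed. -/

section

open Filter Topology ContDiff

/-! ### Plancherel and linearity for the inverse Fourier integral -/

section FourierL2

variable {V : Type*} [NormedAddCommGroup V] [InnerProductSpace ℝ V] [FiniteDimensional ℝ V]
  [MeasurableSpace V] [BorelSpace V]

theorem continuous_fourierInv_of_integrable {g : V → ℂ} (hg : Integrable g) :
    Continuous (𝓕⁻ g) := by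
  rw [fourierInv_eq_fourier_comp_neg]
  exact VectorFourier.fourierIntegral_continuous Real.continuous_fourierChar
    (innerSL ℝ).continuous₂ hg.comp_neg

theorem integral_fourierInv_mul_eq_of_integrable {f g : V → ℂ} (hf : Integrable f)
    (hg : Integrable g) : ∫ x, 𝓕⁻ f x * g x = ∫ x, f x * 𝓕⁻ g x := by
  have h := VectorFourier.integral_fourierIntegral_smul_eq_flip (e := 𝐞) (μ := (volume : Measure V))
    (ν := (volume : Measure V)) (L := -innerₗ V) (f := f) (g := g) Real.continuous_fourierChar
    (by
      change Continuous fun q : V × V => -inner ℝ q.1 q.2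
      fun_prop) hf hg
  have e1 : VectorFourier.fourierIntegral 𝐞 (volume : Measure V) (-innerₗ V) f = 𝓕⁻ f := rfl
  have e2 : VectorFourier.fourierIntegral 𝐞 (volume : Measure V) (-innerₗ V).flip g = 𝓕⁻ g := by
    ext x
    simp [VectorFourier.fourierIntegral, fourierInv_eq, real_inner_comm]
  rw [e1, e2] at h
  simpa using h

/-- The `L²` Fourier transform and the Fourier integral agree on `L¹ ∩ L²`. -/
theorem Lp_fourierInv_toLp_ae_eq {g : V → ℂ} (hg : Integrable g) (hg2 : MemLp g 2) :
    ((𝓕⁻ (hg2.toLp g) : Lp ℂ 2 (volume : Measure V)) : V → ℂ) =ᵐ[volume] 𝓕⁻ g := by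
  refine ae_eq_of_integral_contDiff_smul_eq
    ((Lp.memLp _).locallyIntegrable (by norm_num))
    (continuous_fourierInv_of_integrable hg).locallyIntegrable fun φ hφ hφc => ?_
  have hc : HasCompactSupport (Complex.ofRealCLM ∘ φ) := hφc.comp_left rfl
  have hs : ContDiff ℝ ∞ (Complex.ofRealCLM ∘ φ) := by fun_prop
  let Φ : 𝓢(V, ℂ) := hc.toSchwartzMap hs
  have h1 := congrArg (fun u : 𝓢'(V, ℂ) => u Φ)
    (Lp.fourierInv_toTemperedDistribution_eq (hg2.toLp g))
  simp only [TemperedDistribution.fourierInv_apply, Lp.toTemperedDistribution_apply] at h1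
  have h2 : ∫ x, (𝓕⁻ Φ) x • (hg2.toLp g) x = ∫ x, 𝓕⁻ (Φ : V → ℂ) x * g x := by
    refine integral_congr_ae ?_
    filter_upwards [hg2.coeFn_toLp] with x hx
    rw [hx, SchwartzMap.fourierInv_coe, smul_eq_mul]
  rw [h2, integral_fourierInv_mul_eq_of_integrable Φ.integrable hg] at h1
  simpa [Φ] using h1.symm

/-- Plancherel's theorem for the inverse Fourier integral on `L¹ ∩ L²`. -/
theorem eLpNorm_fourierInv_eq {g : V → ℂ} (hg : Integrable g) (hg2 : MemLp g 2) :
    eLpNorm (𝓕⁻ g) 2 = eLpNorm g 2 := by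
  rw [← eLpNorm_congr_ae (Lp_fourierInv_toLp_ae_eq hg hg2), ← eLpNorm_congr_ae hg2.coeFn_toLp,
    ← ENNReal.toReal_eq_toReal_iff' (Lp.memLp _).eLpNorm_ne_top (Lp.memLp _).eLpNorm_ne_top,
    ← Lp.norm_def, ← Lp.norm_def]
  exact (Lp.fourierTransformₗᵢ V ℂ).symm.norm_map _

theorem memLp_two_fourierInv {g : V → ℂ} (hg : Integrable g) (hg2 : MemLp g 2) :
    MemLp (𝓕⁻ g) 2 :=
  ⟨(continuous_fourierInv_of_integrable hg).aestronglyMeasurable, by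
    rw [eLpNorm_fourierInv_eq hg hg2]; exact hg2.eLpNorm_lt_top⟩

theorem fourierInv_sub_of_integrable {f g : V → ℂ} (hf : Integrable f) (hg : Integrable g) :
    𝓕⁻ (f - g) = 𝓕⁻ f - 𝓕⁻ g := by
  ext x
  simp only [fourierInv_eq, Pi.sub_apply, smul_sub]
  refine integral_sub ?_ ?_ <;>
  · simpa using (Real.fourierIntegral_convergent_iff (-x)).2 ‹_›

theorem fourierInv_add_of_integrable {f g : V → ℂ} (hf : Integrable f) (hg : Integrable g) :
    𝓕⁻ (f + g) = 𝓕⁻ f + 𝓕⁻ g := by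
  ext x
  simp only [fourierInv_eq, Pi.add_apply, smul_add]
  refine integral_add ?_ ?_ <;>
  · simpa using (Real.fourierIntegral_convergent_iff (-x)).2 ‹_›

theorem fourierInv_const_smul (c : ℂ) (f : V → ℂ) : 𝓕⁻ (c • f) = c • 𝓕⁻ f := by
  ext x
  simp only [fourierInv_eq, Pi.smul_apply, ← integral_smul]
  exact integral_congr_ae (.of_forall fun y => smul_comm _ _ _)

theorem contDiff_fourierInv_of_hasCompactSupport {g : V → ℂ} (hg : Continuous g)
    (hgc : HasCompactSupport g) : ContDiff ℝ ∞ (𝓕⁻ g) := by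
  rw [fourierInv_eq_fourier_comp_neg]
  refine Real.contDiff_fourier (N := ⊤) fun n _ => ?_
  have h : Integrable fun v => ‖v‖ ^ n * ‖g v‖ :=
    Continuous.integrable_of_hasCompactSupport (by fun_prop) hgc.norm.mul_left
  simpa using h.comp_neg

end FourierL2

/-! ### Smooth truncation in $L^q$ -/

section Cutoff

variable {V : Type*} [NormedAddCommGroup V] [InnerProductSpace ℝ V] [FiniteDimensional ℝ V]

/-- A smooth cutoff of size comparable to `n + 1`. -/
noncomputable def scaledCutoff (n : ℕ) : ContDiffBump (0 : V) :=
  ⟨n + 1, n + 2, by positivity, by linarith⟩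

theorem tendsto_scaledCutoff (x : V) : Tendsto (fun n => scaledCutoff (V := V) n x) atTop (𝓝 1) := by
  refine tendsto_const_nhds.congr' ?_
  obtain ⟨N, hN⟩ := exists_nat_ge ‖x‖
  filter_upwards [eventually_ge_atTop N] with n hn
  refine (ContDiffBump.one_of_mem_closedBall _ ?_).symm
  have : (N : ℝ) ≤ n := by exact_mod_cast hn
  simp [scaledCutoff]
  linarith

/-- Dominated convergence, with majorant $|h|^q$. The measure is left arbitrary so that the same
truncations converge both in $L^p(\mu)$ and in unweighted $L^2$. -/
theorem tendsto_eLpNorm_scaledCutoff_mul_sub [MeasurableSpace V] [BorelSpace V] {μ : Measure V} {q : ℝ≥0∞} (hq1 : 1 ≤ q) (hq : q ≠ ⊤)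
    {h : V → ℂ} (hh : MemLp h q μ) :
    Tendsto (fun n => eLpNorm ((fun x => (scaledCutoff (V := V) n x : ℂ) * h x) - h) q μ)
      atTop (𝓝 0) := by
  have hq0 : q ≠ 0 := (zero_lt_one.trans_le hq1).ne'
  have hqr : 0 < q.toReal := ENNReal.toReal_pos hq0 hq
  simp only [eLpNorm_eq_lintegral_rpow_enorm_toReal hq0 hq]
  have hm : AEStronglyMeasurable h μ := hh.1
  have key : Tendsto (fun n => ∫⁻ x, ‖((fun x => (scaledCutoff (V := V) n x : ℂ) * h x) - h) x‖ₑ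
      ^ q.toReal ∂μ) atTop (𝓝 (∫⁻ _, 0 ∂μ)) := by
    refine tendsto_lintegral_of_dominated_convergence' (fun x => ‖h x‖ₑ ^ q.toReal)
      (fun n => ?_) (fun n => .of_forall fun x => ?_) ?_ (.of_forall fun x => ?_)
    · have : Continuous fun x => ((scaledCutoff (V := V) n x : ℝ) : ℂ) :=
        Complex.continuous_ofReal.comp (scaledCutoff n).continuous
      exact ((this.aestronglyMeasurable.mul hm).sub hm).enorm.pow_const _
    · dsimp only [Pi.sub_apply]
      gcongr
      rw [enorm_le_iff_norm_le, ← sub_one_mul, norm_mul]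
      refine mul_le_of_le_one_left (norm_nonneg _) ?_
      rw [← Complex.ofReal_one, ← Complex.ofReal_sub, Complex.norm_real, Real.norm_eq_abs, abs_le]
      have := (scaledCutoff (V := V) n).nonneg (x := x)
      have := (scaledCutoff (V := V) n).le_one (x := x)
      constructor <;> linarith
    · exact (lintegral_rpow_enorm_lt_top_of_eLpNorm_lt_top hq0 hq hh.2).ne
    · have h1 : Tendsto (fun n => ((scaledCutoff (V := V) n x : ℝ) : ℂ) * h x - h x) atTop
          (𝓝 (((1 : ℝ) : ℂ) * h x - h x)) :=
        (((Complex.continuous_ofReal.tendsto _).comp (tendsto_scaledCutoff x)).mul_const _).sub_const _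
      have h2 := ((ENNReal.continuous_rpow_const (y := q.toReal)).tendsto _).comp
        ((continuous_enorm.tendsto _).comp h1)
      simpa [hqr, Function.comp_def] using h2
  have := ((ENNReal.continuous_rpow_const (y := 1 / q.toReal)).tendsto _).comp key
  simpa [hqr, Function.comp_def] using this

end Cutoff

/-! ### Algebra of multiplier operators and their resolvents -/

section Multiplier

variable {V : Type*} [NormedAddCommGroup V] [InnerProductSpace ℝ V] [FiniteDimensional ℝ V]
  [MeasurableSpace V] [BorelSpace V] {μ : Measure V} [μ.HasTemperateGrowth] {p : ℝ≥0∞}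
  [Fact (1 ≤ p)]

/-- `S` is the bounded extension to `L^p(μ)` of the Fourier multiplier operator with symbol `a`. -/
def IsMultiplier (a : V → ℂ) (S : Lp ℂ p μ →L[ℂ] Lp ℂ p μ) : Prop :=
  ∀ f : 𝓢(V, ℂ), S (f.toLp p μ) =ᵐ[μ] 𝓕⁻ (fun ξ => a ξ * 𝓕 (f : V → ℂ) ξ)

theorem memLp_mul_of_bound {a g : V → ℂ} (ha : Continuous a) {M : ℝ} (hM : ∀ ξ, ‖a ξ‖ ≤ M)
    {q : ℝ≥0∞} (hg : MemLp g q) : MemLp (fun ξ => a ξ * g ξ) q :=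
  hg.of_le_mul (c := M) (ha.aestronglyMeasurable.mul hg.1) (.of_forall fun ξ => by
    rw [norm_mul]
    gcongr
    exact hM ξ)

theorem integrable_mul_of_bound {a g : V → ℂ} (ha : Continuous a) {M : ℝ} (hM : ∀ ξ, ‖a ξ‖ ≤ M)
    (hg : Integrable g) : Integrable (fun ξ => a ξ * g ξ) :=
  memLp_one_iff_integrable.1 (memLp_mul_of_bound ha hM (memLp_one_iff_integrable.2 hg))

theorem integrable_fourier_schwartz (f : 𝓢(V, ℂ)) : Integrable (𝓕 (f : V → ℂ)) :=
  (𝓕 f).integrable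

theorem memLp_fourier_schwartz (f : 𝓢(V, ℂ)) (q : ℝ≥0∞) : MemLp (𝓕 (f : V → ℂ)) q volume :=
  SchwartzMap.fourier_coe f ▸ (𝓕 f).memLp q

/-- Composition of multipliers leaves the Schwartz class, since a symbol that is merely continuous
destroys smoothness on the frequency side. Truncations of $\mathcal F^{-1}g$ are Schwartz and
converge to it in $L^p(\mu)$ and in $L^2(dx)$. Boundedness of `S` identifies the limit of their
images in the first space, Plancherel in the second; almost everywhere convergent subsequences make
the two limits agree. -/
theorem IsMultiplier.apply_fourierInv (hp : p ≠ ⊤) (hμ : μ ≪ volume) {a : V → ℂ}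
    (ha : Continuous a) {M : ℝ} (hM : ∀ ξ, ‖a ξ‖ ≤ M) {S : Lp ℂ p μ →L[ℂ] Lp ℂ p μ}
    (hS : IsMultiplier a S) {g : V → ℂ} (hg : Continuous g) (hgc : HasCompactSupport g)
    {u : Lp ℂ p μ} (hu : u =ᵐ[μ] 𝓕⁻ g) : S u =ᵐ[μ] 𝓕⁻ (fun ξ => a ξ * g ξ) := by
  have hgi : Integrable g := hg.integrable_of_hasCompactSupport hgc
  have hg2 : MemLp g 2 := hg.memLp_of_hasCompactSupport hgc
  have hh : MemLp (𝓕⁻ g) p μ := (memLp_congr_ae hu).1 (Lp.memLp u)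
  have hs (n : ℕ) : ContDiff ℝ ∞ fun x => (scaledCutoff (V := V) n x : ℂ) * 𝓕⁻ g x :=
    (Complex.ofRealCLM.contDiff.comp (scaledCutoff n).contDiff).mul
      (contDiff_fourierInv_of_hasCompactSupport hg hgc)
  have hc (n : ℕ) : HasCompactSupport fun x => (scaledCutoff (V := V) n x : ℂ) * 𝓕⁻ g x :=
    ((scaledCutoff n).hasCompactSupport.comp_left (g := Complex.ofReal) rfl).mul_right
  let F (n : ℕ) : 𝓢(V, ℂ) := (hc n).toSchwartzMap (hs n)
  have hF1 : Tendsto (fun n => (F n).toLp p μ) atTop (𝓝 u) := by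
    rw [Lp.tendsto_Lp_iff_tendsto_eLpNorm']
    refine (tendsto_eLpNorm_scaledCutoff_mul_sub Fact.out hp hh).congr fun n => ?_
    refine eLpNorm_congr_ae ?_
    filter_upwards [(F n).coeFn_toLp p μ, hu] with x h1 h2
    simp only [Pi.sub_apply, h1, h2]
    rfl
  have hSF := (S.continuous.tendsto u).comp hF1
  obtain ⟨ns, hns, hae⟩ := (tendstoInMeasure_of_tendsto_Lp hSF).exists_seq_tendsto_ae
  have hF2 : Tendsto (fun n => eLpNorm ((F n : V → ℂ) - 𝓕⁻ g) 2) atTop (𝓝 0) :=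
    tendsto_eLpNorm_scaledCutoff_mul_sub (by norm_num) (by norm_num) (memLp_two_fourierInv hgi hg2)
  have hint (n : ℕ) := integrable_fourier_schwartz (F n)
  have hL2 (n : ℕ) := memLp_fourier_schwartz (F n) 2
  have hF3 (n : ℕ) : eLpNorm ((F n : V → ℂ) - 𝓕⁻ g) 2 = eLpNorm (𝓕 (F n : V → ℂ) - g) 2 := by
    rw [← eLpNorm_fourierInv_eq ((hint n).sub hgi) ((hL2 n).sub hg2),
      fourierInv_sub_of_integrable (hint n) hgi]
    congr 2
    exact ((F n).continuous.fourierInv_fourier_eq (F n).integrable (hint n)).symm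
  have hF4 : Tendsto (fun n => eLpNorm (𝓕⁻ (fun ξ => a ξ * 𝓕 (F n : V → ℂ) ξ) -
      𝓕⁻ (fun ξ => a ξ * g ξ)) 2) atTop (𝓝 0) := by
    have h0 : Tendsto (fun n => ENNReal.ofReal M * eLpNorm ((F n : V → ℂ) - 𝓕⁻ g) 2) atTop
        (𝓝 0) := by
      simpa using ENNReal.Tendsto.const_mul hF2 (.inr ENNReal.ofReal_ne_top)
    refine tendsto_of_tendsto_of_tendsto_of_le_of_le tendsto_const_nhds h0
      (fun _ => zero_le) fun n => ?_
    have hi1 := integrable_mul_of_bound ha hM (hint n)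
    have hi2 := integrable_mul_of_bound ha hM hgi
    have hm1 := memLp_mul_of_bound ha hM (hL2 n)
    have hm2 := memLp_mul_of_bound ha hM hg2
    dsimp only
    rw [← fourierInv_sub_of_integrable hi1 hi2,
      eLpNorm_fourierInv_eq (hi1.sub hi2) (hm1.sub hm2), hF3]
    refine eLpNorm_le_mul_eLpNorm_of_ae_le_mul (.of_forall fun ξ => ?_) 2
    simp only [Pi.sub_apply, ← mul_sub, norm_mul]
    gcongr
    exact hM ξ
  have hF5 : TendstoInMeasure volume (fun n => 𝓕⁻ (fun ξ => a ξ * 𝓕 (F n : V → ℂ) ξ)) atTop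
      (𝓕⁻ (fun ξ => a ξ * g ξ)) := by
    refine tendstoInMeasure_of_tendsto_eLpNorm (by norm_num) (fun n => ?_) ?_ hF4
    · exact (continuous_fourierInv_of_integrable
        (integrable_mul_of_bound ha hM (hint n))).aestronglyMeasurable
    · exact (continuous_fourierInv_of_integrable
        (integrable_mul_of_bound ha hM hgi)).aestronglyMeasurable
  -- The second subsequence is extracted from the first, so both limits hold along it; the
  -- Lebesgue-null exceptional set is $\mu$-null.
  obtain ⟨ms, hms, hae2⟩ := (hF5.comp hns.tendsto_atTop).exists_seq_tendsto_ae
  have hall : ∀ᵐ x ∂μ, ∀ n, S ((F n).toLp p μ) x = 𝓕⁻ (fun ξ => a ξ * 𝓕 (F n : V → ℂ) ξ) x :=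
    ae_all_iff.2 fun n => hS (F n)
  filter_upwards [hae, hμ.ae_le hae2, hall] with x h1 h2 h3
  refine tendsto_nhds_unique (h1.comp hms.tendsto_atTop) ?_
  simpa only [Function.comp_def, h3] using h2

theorem IsMultiplier.ext [IsFiniteMeasureOnCompacts μ] (hp : p ≠ ⊤) {a : V → ℂ}
    {S R : Lp ℂ p μ →L[ℂ] Lp ℂ p μ} (hS : IsMultiplier a S) (hR : IsMultiplier a R) : S = R := by
  have hd := SchwartzMap.denseRange_toLpCLM (E := V) (F := ℂ) (μ := μ) hp
  refine DFunLike.coe_injective (hd.equalizer S.continuous R.continuous (funext fun f => ?_))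
  exact Lp.ext ((hS f).trans (hR f).symm)

theorem IsMultiplier.add {a b : V → ℂ} {S R : Lp ℂ p μ →L[ℂ] Lp ℂ p μ} (ha : Continuous a)
    {M : ℝ} (hM : ∀ ξ, ‖a ξ‖ ≤ M) (hb : Continuous b) {N : ℝ} (hN : ∀ ξ, ‖b ξ‖ ≤ N)
    (hS : IsMultiplier a S) (hR : IsMultiplier b R) : IsMultiplier (a + b) (S + R) := by
  intro f
  filter_upwards [hS f, hR f, Lp.coeFn_add (S (f.toLp p μ)) (R (f.toLp p μ))] with x h1 h2 h3
  rw [add_apply, h3, Pi.add_apply, h1, h2, ← Pi.add_apply,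
    ← fourierInv_add_of_integrable
      (integrable_mul_of_bound ha hM (integrable_fourier_schwartz f))
      (integrable_mul_of_bound hb hN (integrable_fourier_schwartz f))]
  refine congrArg (fun g : V → ℂ => 𝓕⁻ g x) (funext fun ξ => ?_)
  simp [add_mul]

theorem IsMultiplier.smul {a : V → ℂ} {S : Lp ℂ p μ →L[ℂ] Lp ℂ p μ} (c : ℂ)
    (hS : IsMultiplier a S) : IsMultiplier (c • a) (c • S) := by
  intro f
  filter_upwards [hS f, Lp.coeFn_smul c (S (f.toLp p μ))] with x h1 h2
  rw [smul_apply, h2, Pi.smul_apply, h1, ← Pi.smul_apply,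
    ← fourierInv_const_smul]
  refine congrArg (fun g : V → ℂ => 𝓕⁻ g x) (funext fun ξ => ?_)
  simp [mul_assoc]

/-- The compact support of `b` makes $b\hat f$ continuous with compact support, as
`IsMultiplier.apply_fourierInv` requires. -/
theorem IsMultiplier.mul (hp : p ≠ ⊤) (hμ : μ ≪ volume) {a b : V → ℂ}
    {S R : Lp ℂ p μ →L[ℂ] Lp ℂ p μ} (ha : Continuous a) {M : ℝ} (hM : ∀ ξ, ‖a ξ‖ ≤ M)
    (hb : Continuous b) (hbc : HasCompactSupport b)
    (hS : IsMultiplier a S) (hR : IsMultiplier b R) : IsMultiplier (a * b) (S * R) := by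
  intro f
  have := hS.apply_fourierInv hp hμ ha hM (g := fun ξ => b ξ * 𝓕 (f : V → ℂ) ξ)
    (hb.mul (𝓕 f).continuous) hbc.mul_right (hR f)
  simpa [mul_assoc] using this

theorem IsMultiplier.pow (hp : p ≠ ⊤) (hμ : μ ≪ volume) {a : V → ℂ}
    {S : Lp ℂ p μ →L[ℂ] Lp ℂ p μ} (ha : Continuous a) (hac : HasCompactSupport a)
    (hS : IsMultiplier a S) (k : ℕ) : IsMultiplier (a ^ (k + 1)) (S ^ (k + 1)) := by
  obtain ⟨M, hM⟩ := hac.exists_bound_of_continuous ha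
  induction k with
  | zero => simpa using hS
  | succ k ih =>
    rw [pow_succ' a, pow_succ' S]
    exact hS.mul hp hμ ha hM (ha.pow _) (by rw [pow_succ]; exact hac.mul_left) ih

/-- Every compactly supported symbol of class `C^N` is an `L^p(μ)` multiplier. -/
def HasSmoothMultipliers (p : ℝ≥0∞) [Fact (1 ≤ p)] (μ : Measure V) [μ.HasTemperateGrowth]
    (N : ℕ) : Prop :=
  ∀ b : V → ℂ, ContDiff ℝ N b → HasCompactSupport b →
    ∃ S : Lp ℂ p μ →L[ℂ] Lp ℂ p μ, IsMultiplier b S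

/-- The resolvent symbol $(z-b)^{-1}$ is not compactly supported, but it equals $z^{-1}+c$ with
$c=b/(z(z-b))$, which has the support and smoothness of $b$. If `R` is the multiplier with symbol
$c$, the inverse is $z^{-1}+R$. -/
theorem IsMultiplier.notMem_spectrum [IsFiniteMeasureOnCompacts μ] (hp : p ≠ ⊤) (hμ : μ ≪ volume)
    {N : ℕ} (hN : HasSmoothMultipliers p μ N) {b : V → ℂ} (hb : ContDiff ℝ N b)
    (hbc : HasCompactSupport b) {S : Lp ℂ p μ →L[ℂ] Lp ℂ p μ} (hS : IsMultiplier b S) {z : ℂ}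
    (hz : z ≠ 0) (hzb : ∀ ξ, b ξ ≠ z) : z ∉ spectrum ℂ S := by
  have hne (ξ : V) : z - b ξ ≠ 0 := sub_ne_zero.2 (hzb ξ).symm
  let c : V → ℂ := fun ξ => b ξ * (z * (z - b ξ))⁻¹
  have hc : ContDiff ℝ N c :=
    hb.mul ((contDiff_const.mul (contDiff_const.sub hb)).inv fun ξ => mul_ne_zero hz (hne ξ))
  have hcc : HasCompactSupport c := hbc.mul_right
  obtain ⟨R, hR⟩ := hN c hc hcc
  obtain ⟨B, hB⟩ := hbc.exists_bound_of_continuous hb.continuous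
  obtain ⟨C, hC⟩ := hcc.exists_bound_of_continuous hc.continuous
  have hbound {f : V → ℂ} {M : ℝ} (h : ∀ ξ, ‖f ξ‖ ≤ M) (w : ℂ) : ∀ ξ, ‖(w • f) ξ‖ ≤ ‖w‖ * M :=
    fun ξ => by
      rw [Pi.smul_apply, norm_smul]
      exact mul_le_mul_of_nonneg_left (h ξ) (norm_nonneg _)
  -- The pointwise identity $bc=zc-z^{-1}b$, together with uniqueness of multiplier operators,
  -- computes both $SR$ and $RS$.
  have hlin : IsMultiplier (b * c) (z • R + (-z⁻¹) • S) := by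
    have h := (hR.smul z).add (hc.continuous.const_smul z) (hbound hC z)
      (hb.continuous.const_smul (-z⁻¹)) (hbound hB _) (hS.smul (-z⁻¹))
    convert h using 1
    ext ξ
    have := hne ξ
    simp only [c, Pi.mul_apply, Pi.add_apply, Pi.smul_apply, smul_eq_mul]
    field_simp
    ring
  have h1 : S * R = z • R + (-z⁻¹) • S :=
    (hS.mul hp hμ hb.continuous hB hc.continuous hcc hR).ext hp hlin
  have h2 : R * S = z • R + (-z⁻¹) • S := by
    refine IsMultiplier.ext hp ?_ hlin
    rw [mul_comm b c]
    exact hR.mul hp hμ hc.continuous hC hb.continuous hbc hS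
  rw [spectrum.mem_iff, not_not]
  refine ⟨⟨algebraMap ℂ _ z - S, z⁻¹ • 1 + R, ?_, ?_⟩, rfl⟩
  · rw [sub_mul, mul_add, mul_add, h1, Algebra.algebraMap_eq_smul_one]
    simp [hz]
  · rw [add_mul, mul_sub, mul_sub, h2, Algebra.algebraMap_eq_smul_one]
    simp [hz]

end Multiplier

/-! ### The two spectral inclusions for an abstract symbol -/

section Spectrum

variable {V : Type*} [NormedAddCommGroup V] [InnerProductSpace ℝ V] [FiniteDimensional ℝ V]
  [MeasurableSpace V] [BorelSpace V] {μ : Measure V} [μ.HasTemperateGrowth]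
  [IsFiniteMeasureOnCompacts μ] {p : ℝ≥0∞} [Fact (1 ≤ p)]

/-- For $z\neq0$, $z$ is the quotient of its two consecutive powers, hence real and nonnegative; its
size is then controlled by $z^{k+1}\le1$. -/
theorem mem_ofReal_image_Icc_of_pow_mem {z : ℂ} {k : ℕ}
    (h1 : z ^ k ∈ Complex.ofReal '' Set.Icc (0 : ℝ) 1)
    (h2 : z ^ (k + 1) ∈ Complex.ofReal '' Set.Icc (0 : ℝ) 1) :
    z ∈ Complex.ofReal '' Set.Icc (0 : ℝ) 1 := by
  rcases eq_or_ne z 0 with rfl | hz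
  · exact ⟨0, by simp, by simp⟩
  obtain ⟨s, hs, hs'⟩ := h1
  obtain ⟨t, ht, ht'⟩ := h2
  have hzst : z = ((t / s : ℝ) : ℂ) := by
    rw [Complex.ofReal_div, hs', ht', pow_succ, mul_div_cancel_left₀ _ (pow_ne_zero k hz)]
  have h0 : 0 ≤ t / s := div_nonneg ht.1 hs.1
  refine ⟨t / s, ⟨h0, ?_⟩, hzst.symm⟩
  have : (t / s) ^ (k + 1) = t := by
    have := ht'
    rw [hzst] at this
    exact_mod_cast this.symm
  exact (pow_le_one_iff_of_nonneg h0 k.succ_ne_zero).1 (this.le.trans ht.2)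

/-- Taking powers trades the low regularity of $a$ for $C^N$ regularity, and only the easy inclusion
$\sigma(T)^k\subseteq\sigma(T^k)$ is needed. -/
theorem IsMultiplier.spectrum_subset (hp : p ≠ ⊤) (hμ : μ ≪ volume)
    {N : ℕ} (hN : HasSmoothMultipliers p μ N) {a : V → ℝ} (ha : Continuous a)
    (hac : HasCompactSupport a) (ha01 : ∀ ξ, a ξ ∈ Set.Icc (0 : ℝ) 1) {k₀ : ℕ}
    (hk₀ : ∀ k ≥ k₀, ContDiff ℝ N (a ^ k)) {T : Lp ℂ p μ →L[ℂ] Lp ℂ p μ}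
    (hT : IsMultiplier (fun ξ => (a ξ : ℂ)) T) :
    spectrum ℂ T ⊆ Complex.ofReal '' Set.Icc (0 : ℝ) 1 := by
  intro z hz
  have key : ∀ k ≥ k₀, z ^ (k + 1) ∈ Complex.ofReal '' Set.Icc (0 : ℝ) 1 := by
    intro k hk
    by_contra hcon
    have hcc : HasCompactSupport fun ξ => (a ξ : ℂ) := hac.comp_left (g := Complex.ofReal) rfl
    have hpow := hT.pow hp hμ (Complex.continuous_ofReal.comp ha) hcc k
    have hsm : ContDiff ℝ N ((fun ξ => (a ξ : ℂ)) ^ (k + 1)) := by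
      have : ContDiff ℝ N (Complex.ofRealCLM ∘ (a ^ (k + 1))) :=
        Complex.ofRealCLM.contDiff.comp (hk₀ (k + 1) (by omega))
      convert this using 1
      ext ξ
      simp
    have hcs : HasCompactSupport ((fun ξ => (a ξ : ℂ)) ^ (k + 1)) := by
      rw [pow_succ]; exact hcc.mul_left
    refine hpow.notMem_spectrum hp hμ hN hsm hcs ?_ (fun ξ hξ => hcon ?_)
      (spectrum.pow_mem_pow T (k + 1) hz)
    · intro h0
      exact hcon ⟨0, by simp, by simp [h0]⟩
    · refine ⟨a ξ ^ (k + 1), ⟨pow_nonneg (ha01 ξ).1 _, pow_le_one₀ (ha01 ξ).1 (ha01 ξ).2⟩, ?_⟩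
      rw [← hξ]
      simp
  exact mem_ofReal_image_Icc_of_pow_mem (key k₀ le_rfl) (key (k₀ + 1) (by omega))

/-- Gelfand's formula. -/
theorem exists_norm_pow_le_of_spectralRadius_lt {A : Type*} [NormedRing A] [NormedAlgebra ℂ A]
    [CompleteSpace A] {x : A} {r : ℝ≥0} (h : spectralRadius ℂ x < r) :
    ∀ᶠ n : ℕ in atTop, ‖x ^ n‖ ≤ (r : ℝ) ^ n := by
  filter_upwards [(spectrum.pow_nnnorm_pow_one_div_tendsto_nhds_spectralRadius x).eventually_lt_const
    h, eventually_gt_atTop 0] with n hn hn0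
  have h1 := ENNReal.rpow_le_rpow hn.le (Nat.cast_nonneg n : (0 : ℝ) ≤ n)
  rw [← ENNReal.rpow_mul, one_div_mul_cancel (by positivity), ENNReal.rpow_one,
    ENNReal.rpow_natCast] at h1
  exact_mod_cast h1

/-- A small symbol need not give an operator of small norm on $L^p(\mu)$, but it does give one of
small spectral radius. Hence the contradiction comes from high powers of the localised operator, not
from the operator itself. -/
theorem IsMultiplier.mem_spectrum (hp : p ≠ ⊤) (hμ : μ ≪ volume) [μ.IsOpenPosMeasure]
    {N : ℕ} (hN : HasSmoothMultipliers p μ N) {a : V → ℝ} (ha : Continuous a)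
    (hac : HasCompactSupport a) {ξ₀ : V} {s : ℝ} (hs : 0 < s)
    (hsm : ContDiffOn ℝ ∞ a (Metric.ball ξ₀ s)) {T : Lp ℂ p μ →L[ℂ] Lp ℂ p μ}
    (hT : IsMultiplier (fun ξ => (a ξ : ℂ)) T) : (a ξ₀ : ℂ) ∈ spectrum ℂ T := by
  by_contra hcon
  rw [spectrum.mem_iff, not_not] at hcon
  obtain ⟨U, hU⟩ := hcon
  set z : ℂ := (a ξ₀ : ℂ) with hzdef
  set R : Lp ℂ p μ →L[ℂ] Lp ℂ p μ := ↑U⁻¹ with hR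
  have hRU : R * (algebraMap ℂ _ z - T) = 1 := by rw [← hU]; exact U.inv_mul
  -- The factor 2 leaves room between the spectral radius, at most $\eta$, and the base $2\eta$ of
  -- the power bound.
  obtain ⟨η, hη0, hη⟩ : ∃ η : ℝ, 0 < η ∧ 2 * η * ‖R‖ < 1 := by
    refine ⟨1 / (2 * (‖R‖ + 1)), by positivity, ?_⟩
    rw [show 2 * (1 / (2 * (‖R‖ + 1))) * ‖R‖ = ‖R‖ / (‖R‖ + 1) by field_simp,
      div_lt_one (by positivity)]
    linarith
  obtain ⟨r, hr0, hrs, hrη⟩ : ∃ r : ℝ, 0 < r ∧ r < s ∧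
      ∀ ξ ∈ Metric.ball ξ₀ r, ‖z - a ξ‖ ≤ η := by
    obtain ⟨ε, hε, h⟩ := Metric.continuous_iff.1 ha ξ₀ η hη0
    refine ⟨min ε (s / 2), by positivity, (min_le_right _ _).trans_lt (by linarith),
      fun ξ hξ => ?_⟩
    have := h ξ ((Metric.mem_ball.1 hξ).trans_le (min_le_left _ _))
    rw [hzdef, ← Complex.ofReal_sub, Complex.norm_real, ← dist_eq_norm, dist_comm]
    exact this.le
  -- The radii are nested so that $\chi=1$ on the support of $\psi$, while $\chi$ lives where $a$ is
  -- smooth and within $\eta$ of $z$.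
  let χ : ContDiffBump ξ₀ := ⟨r / 2, r, by positivity, by linarith⟩
  let ψ : ContDiffBump ξ₀ := ⟨r / 4, r / 2, by positivity, by linarith⟩
  let b : V → ℂ := fun ξ => (χ ξ : ℂ)
  let e : V → ℂ := fun ξ => (z - a ξ) * χ ξ
  have hb : ContDiff ℝ ∞ b := Complex.ofRealCLM.contDiff.comp χ.contDiff
  have hbc : HasCompactSupport b := χ.hasCompactSupport.comp_left (g := Complex.ofReal) rfl
  have he : ContDiff ℝ ∞ e := by
    rw [contDiff_iff_contDiffAt]
    intro ξ
    by_cases hξ : ξ ∈ Metric.ball ξ₀ s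
    · have h1 : ContDiffAt ℝ ∞ (fun ξ => (a ξ : ℂ)) ξ :=
        Complex.ofRealCLM.contDiff.contDiffAt.comp ξ
          (hsm.contDiffAt (Metric.isOpen_ball.mem_nhds hξ))
      exact (contDiffAt_const.sub h1).mul hb.contDiffAt
    · have h2 : (χ : V → ℝ) =ᶠ[𝓝 ξ] 0 := by
        rw [← notMem_tsupport_iff_eventuallyEq, χ.tsupport_eq]
        intro hmem
        exact hξ (Metric.closedBall_subset_ball hrs hmem)
      refine (contDiffAt_const (c := (0 : ℂ))).congr_of_eventuallyEq ?_
      filter_upwards [h2] with y hy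
      simp [e, hy]
  have hec : HasCompactSupport e := hbc.mul_left
  have heη (ξ : V) : ‖e ξ‖ ≤ η := by
    by_cases hξ : ξ ∈ Metric.ball ξ₀ r
    · rw [norm_mul, Complex.norm_real, Real.norm_of_nonneg χ.nonneg]
      exact (mul_le_of_le_one_right (norm_nonneg _) χ.le_one).trans (hrη ξ hξ)
    · have : χ ξ = 0 := by
        rw [← Function.notMem_support, χ.support_eq]
        exact hξ
      simp [e, this, hη0.le]
  obtain ⟨B, hB⟩ := hN b (hb.of_le (by exact_mod_cast le_top)) hbc
  obtain ⟨Mb, hMb⟩ := hbc.exists_bound_of_continuous hb.continuous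
  have haC : Continuous fun ξ => (a ξ : ℂ) := Complex.continuous_ofReal.comp ha
  have hacC : HasCompactSupport fun ξ => (a ξ : ℂ) := hac.comp_left (g := Complex.ofReal) rfl
  obtain ⟨Ma, hMa⟩ := hacC.exists_bound_of_continuous haC
  have hTB := hT.mul hp hμ haC hMa hb.continuous hbc hB
  have hBT := hB.mul hp hμ hb.continuous hMb haC hacC hT
  have hcomm : Commute T B := hTB.ext hp (by rwa [mul_comm] at hBT)
  set D : Lp ℂ p μ →L[ℂ] Lp ℂ p μ := algebraMap ℂ _ z - T with hD
  have hDB : Commute D B := (Algebra.commute_algebraMap_left z B).sub_left hcomm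
  -- Since $e+ab=zb$, uniqueness gives $E+TB=zB$ for the multiplier `E` with symbol $e$, so $E=DB$.
  have hA : IsMultiplier e (D * B) := by
    obtain ⟨E, hE⟩ := hN e (he.of_le (by exact_mod_cast le_top)) hec
    have h1 : IsMultiplier (z • b) (E + T * B) := by
      have := hE.add he.continuous heη
        (haC.mul hb.continuous) (N := Ma * Mb) (fun ξ => by
          rw [Pi.mul_apply, norm_mul]
          exact mul_le_mul (hMa ξ) (hMb ξ) (norm_nonneg _) ((norm_nonneg _).trans (hMa ξ))) hTB
      convert this using 1
      ext ξ
      simp only [Pi.smul_apply, Pi.add_apply, Pi.mul_apply, smul_eq_mul, e, b]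
      ring
    have h2 := h1.ext hp (hB.smul z)
    rwa [hD, sub_mul, Algebra.algebraMap_eq_smul_one, smul_mul_assoc, one_mul, ← h2,
      add_sub_cancel_right]
  -- The symbol $e$ takes no value of modulus above $\eta$, so every such number lies in the
  -- resolvent set.
  have hrad : spectralRadius ℂ (D * B) < (2 * η).toNNReal := by
    refine lt_of_le_of_lt (b := (η.toNNReal : ℝ≥0∞)) (iSup₂_le fun w hw => ?_) ?_
    · by_contra hlt
      have hlt' : η < ‖w‖ := by
        rw [not_le] at hlt
        have := (ENNReal.coe_lt_coe.1 hlt)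
        rwa [Real.toNNReal_lt_iff_lt_coe hη0.le] at this
      refine hA.notMem_spectrum hp hμ hN (he.of_le (by exact_mod_cast le_top)) hec ?_ ?_ hw
      · rintro rfl
        simp at hlt'
        linarith
      · rintro ξ rfl
        exact absurd (heη ξ) (not_le.2 hlt')
    · rw [ENNReal.coe_lt_coe, Real.toNNReal_lt_toNNReal_iff (by linarith)]
      linarith
  obtain ⟨k, hk, hk0⟩ :=
    ((exists_norm_pow_le_of_spectralRadius_lt hrad).and (eventually_gt_atTop 0)).exists
  rw [Real.coe_toNNReal _ (by linarith)] at hk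
  have hψs : ContDiff ℝ ∞ fun ξ => (ψ ξ : ℂ) := Complex.ofRealCLM.contDiff.comp ψ.contDiff
  have hψc : HasCompactSupport fun ξ => (ψ ξ : ℂ) :=
    ψ.hasCompactSupport.comp_left (g := Complex.ofReal) rfl
  let Ψ : 𝓢(V, ℂ) := hψc.toSchwartzMap hψs
  -- The test function has Fourier transform $\psi$; as $\chi\psi=\psi$, it is fixed by `B`.
  let f : 𝓢(V, ℂ) := 𝓕⁻ Ψ
  have hFf : 𝓕 (f : V → ℂ) = Ψ := by
    rw [← SchwartzMap.fourier_coe, FourierTransform.fourier_fourierInv_eq]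
  have hBf : B (f.toLp p μ) = f.toLp p μ := by
    refine Lp.ext ((hB f).trans (EventuallyEq.trans (.of_eq ?_) (f.coeFn_toLp p μ).symm))
    rw [hFf, show (f : V → ℂ) = 𝓕⁻ (Ψ : V → ℂ) from SchwartzMap.fourierInv_coe Ψ]
    refine congrArg _ (funext fun ξ => ?_)
    change (χ ξ : ℂ) * (ψ ξ : ℂ) = (ψ ξ : ℂ)
    by_cases hξ : ξ ∈ Metric.ball ξ₀ (r / 2)
    · rw [χ.one_of_mem_closedBall (Metric.ball_subset_closedBall hξ)]
      simp
    · have : ψ ξ = 0 := by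
        rw [← Function.notMem_support, ψ.support_eq]
        exact hξ
      simp [this]
  have hf0 : f.toLp p μ ≠ 0 := by
    intro h0
    have h1 : f = 0 := SchwartzMap.injective_toLp p μ (by
      change f.toLp p μ = (0 : 𝓢(V, ℂ)).toLp p μ
      rw [h0]
      exact ((SchwartzMap.toLpCLM ℂ ℂ p μ).map_zero).symm)
    have h2 : Ψ = 0 := by
      have : 𝓕 f = Ψ := FourierTransform.fourier_fourierInv_eq _
      rw [← this, h1]
      exact FourierTransform.fourier_zero
    have h3 := congrArg (fun g : 𝓢(V, ℂ) => g ξ₀) h2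
    have h4 : ψ ξ₀ = 1 := ψ.one_of_mem_closedBall (Metric.mem_closedBall_self (by positivity))
    simp [Ψ, h4] at h3
  have hpowB : (B ^ k) (f.toLp p μ) = f.toLp p μ := by
    clear hk hk0
    induction k with
    | zero => rfl
    | succ k ih => rw [pow_succ, mul_apply_eq_comp, hBf, ih]
  have hRD : Commute R D := by
    rw [hR, ← hU]
    exact U.inv_mul.trans U.mul_inv.symm
  -- `D` commutes with both `B` and `R`, so the $k$-th powers split and $R^kD^k=1$.
  have hpow : R ^ k * (D * B) ^ k = B ^ k := by
    rw [hDB.mul_pow, ← mul_assoc, ← hRD.mul_pow, hRU, one_pow, one_mul]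
  have hle : ‖f.toLp p μ‖ ≤ (2 * η * ‖R‖) ^ k * ‖f.toLp p μ‖ := by
    calc ‖f.toLp p μ‖ = ‖(R ^ k * (D * B) ^ k) (f.toLp p μ)‖ := by rw [hpow, hpowB]
      _ ≤ ‖R ^ k * (D * B) ^ k‖ * ‖f.toLp p μ‖ := ContinuousLinearMap.le_opNorm _ _
      _ ≤ _ := by
        gcongr
        refine (norm_mul_le _ _).trans ?_
        rw [mul_comm, mul_pow]
        exact mul_le_mul hk (norm_pow_le' _ hk0) (norm_nonneg _) (by positivity)
  have hlt : (2 * η * ‖R‖) ^ k < 1 := pow_lt_one₀ (by positivity) hη hk0.ne'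
  have := norm_pos_iff.2 hf0
  nlinarith

end Spectrum

/-! ### Extension from Schwartz functions, and kernel estimates -/

section Extension

variable {V : Type*} [NormedAddCommGroup V] [InnerProductSpace ℝ V] [FiniteDimensional ℝ V]
  [MeasurableSpace V] [BorelSpace V]

theorem fourierInv_mul_fourier_add {a : V → ℂ} (ha : Continuous a) {M : ℝ} (hM : ∀ ξ, ‖a ξ‖ ≤ M)
    (f g : 𝓢(V, ℂ)) : 𝓕⁻ (fun ξ => a ξ * 𝓕 (⇑(f + g) : V → ℂ) ξ) =
      𝓕⁻ (fun ξ => a ξ * 𝓕 (f : V → ℂ) ξ) + 𝓕⁻ (fun ξ => a ξ * 𝓕 (g : V → ℂ) ξ) := by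
  rw [← fourierInv_add_of_integrable
    (integrable_mul_of_bound ha hM (integrable_fourier_schwartz f))
    (integrable_mul_of_bound ha hM (integrable_fourier_schwartz g))]
  refine congrArg _ (funext fun ξ => ?_)
  rw [← SchwartzMap.fourier_coe, FourierTransform.fourier_add]
  simp [mul_add, SchwartzMap.fourier_coe]

theorem fourierInv_mul_fourier_smul (a : V → ℂ) (c : ℂ) (f : 𝓢(V, ℂ)) :
    𝓕⁻ (fun ξ => a ξ * 𝓕 (⇑(c • f) : V → ℂ) ξ) = c • 𝓕⁻ (fun ξ => a ξ * 𝓕 (f : V → ℂ) ξ) := by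
  rw [← fourierInv_const_smul]
  refine congrArg _ (funext fun ξ => ?_)
  rw [← SchwartzMap.fourier_coe, FourierTransform.fourier_smul]
  simp [SchwartzMap.fourier_coe, mul_left_comm]

theorem memLp_fourierInv_mul_fourier {μ : Measure V} [μ.HasTemperateGrowth] {p : ℝ≥0∞} {a : V → ℂ}
    (ha : Continuous a) {M : ℝ} (hM : ∀ ξ, ‖a ξ‖ ≤ M) {C : ℝ≥0} (f : 𝓢(V, ℂ))
    (hf : eLpNorm (𝓕⁻ (fun ξ => a ξ * 𝓕 (f : V → ℂ) ξ)) p μ ≤ C * eLpNorm f p μ) :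
    MemLp (𝓕⁻ (fun ξ => a ξ * 𝓕 (f : V → ℂ) ξ)) p μ :=
  ⟨(continuous_fourierInv_of_integrable
    (integrable_mul_of_bound ha hM (integrable_fourier_schwartz f))).aestronglyMeasurable,
    hf.trans_lt (ENNReal.mul_lt_top ENNReal.coe_lt_top (f.eLpNorm_lt_top p μ))⟩

theorem exists_isMultiplier_of_bound {μ : Measure V} [μ.HasTemperateGrowth]
    [IsFiniteMeasureOnCompacts μ] {p : ℝ≥0∞} [Fact (1 ≤ p)] (hp : p ≠ ⊤) {a : V → ℂ}
    (ha : Continuous a) {M : ℝ} (hM : ∀ ξ, ‖a ξ‖ ≤ M) {C : ℝ≥0}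
    (hC : ∀ f : 𝓢(V, ℂ), eLpNorm (𝓕⁻ (fun ξ => a ξ * 𝓕 (f : V → ℂ) ξ)) p μ ≤ C * eLpNorm f p μ) :
    ∃ S : Lp ℂ p μ →L[ℂ] Lp ℂ p μ, IsMultiplier a S := by
  have hmem (f : 𝓢(V, ℂ)) := memLp_fourierInv_mul_fourier ha hM f (hC f)
  let L : 𝓢(V, ℂ) →ₗ[ℂ] Lp ℂ p μ :=
    { toFun := fun f => (hmem f).toLp _
      map_add' := fun f g => by
        rw [← MemLp.toLp_add]
        exact MemLp.toLp_congr _ _ (.of_eq (fourierInv_mul_fourier_add ha hM f g))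
      map_smul' := fun c f => by
        rw [RingHom.id_apply, ← MemLp.toLp_const_smul]
        exact MemLp.toLp_congr _ _ (.of_eq (fourierInv_mul_fourier_smul a c f)) }
  have hd : DenseRange (SchwartzMap.toLpCLM ℂ (E := V) ℂ p μ).toLinearMap :=
    SchwartzMap.denseRange_toLpCLM (E := V) (F := ℂ) (μ := μ) hp
  refine ⟨L.extendOfNorm (SchwartzMap.toLpCLM ℂ (E := V) ℂ p μ).toLinearMap, fun f => ?_⟩
  have h := L.extendOfNorm_eq hd ⟨C, fun f => ?_⟩ f
  · exact (congrArg (fun u : Lp ℂ p μ => (u : V → ℂ)) h).eventuallyEq.trans (hmem f).coeFn_toLp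
  · change ‖(hmem f).toLp _‖ ≤ C * ‖f.toLp p μ‖
    rw [Lp.norm_toLp, SchwartzMap.norm_toLp, ← ENNReal.coe_toReal C, ← ENNReal.toReal_mul]
    exact ENNReal.toReal_mono
      (ENNReal.mul_ne_top ENNReal.coe_ne_top (f.eLpNorm_lt_top p μ).ne) (hC f)

/-- The multiplier is convolution with $\mathcal F^{-1}b$: the Fourier transform is moved from $f$
onto the modulated symbol $e^{2\pi i\xi\cdot x}b(\xi)$, which needs only integrability of $b$ and
$f$. -/
theorem enorm_fourierInv_mul_fourier_le {b : V → ℂ} (hb : Integrable b) {f : V → ℂ}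
    (hf : Integrable f) (x : V) :
    ‖𝓕⁻ (fun ξ => b ξ * 𝓕 f ξ) x‖ₑ ≤ ∫⁻ y, ‖𝓕⁻ b (x - y)‖ₑ * ‖f y‖ₑ := by
  let g : V → ℂ := fun ξ => 𝐞 (inner ℝ ξ x) • b ξ
  have hg : Integrable g := by
    simpa [g] using (Real.fourierIntegral_convergent_iff (-x)).2 hb
  have hFg (y : V) : 𝓕 g y = 𝓕⁻ b (x - y) := by
    simp only [g, fourier_eq, fourierInv_eq, smul_smul, ← AddChar.map_add_eq_mul, inner_sub_right]
    congr! 4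
    ring
  have h := VectorFourier.integral_fourierIntegral_smul_eq_flip (e := 𝐞) (μ := (volume : Measure V))
    (ν := (volume : Measure V)) (L := innerₗ V) (f := f) (g := g) Real.continuous_fourierChar
    (by exact continuous_inner) hf hg
  rw [flip_innerₗ] at h
  have h' : 𝓕⁻ (fun ξ => b ξ * 𝓕 f ξ) x = ∫ y, f y * 𝓕⁻ b (x - y) := by
    simp only [← hFg]
    refine Eq.trans ?_ h
    rw [fourierInv_eq]
    refine integral_congr_ae (.of_forall fun ξ => ?_)
    change _ = 𝓕 f ξ • (𝐞 (inner ℝ ξ x) • b ξ)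
    simp only [smul_eq_mul, Circle.smul_def]
    ring
  rw [h']
  refine (enorm_integral_le_lintegral_enorm _).trans_eq (lintegral_congr fun y => ?_)
  rw [enorm_mul, mul_comm]

/-- Each derivative of the symbol buys one power of decay of the kernel. The powers $0$ and $N$ of
$|x|$ suffice, because $(1+|x|)^N\le2^{N-1}(1+|x|^N)$. -/
theorem exists_pow_mul_norm_fourierInv_le {b : V → ℂ} {N : ℕ} (hb : ContDiff ℝ N b)
    (hbc : HasCompactSupport b) : ∃ D : ℝ, ∀ x, (1 + ‖x‖) ^ N * ‖𝓕⁻ b x‖ ≤ D := by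
  have h1 (n : ℕ) (hn : n ≤ N) : ∃ D : ℝ, ∀ x, ‖x‖ ^ n * ‖𝓕⁻ b x‖ ≤ D := by
    obtain ⟨D, hD⟩ : ∃ D : ℝ, ∀ w, ‖w‖ ^ n * ‖iteratedFDeriv ℝ 0 (𝓕 b) w‖ ≤ D :=
      ⟨_, Real.pow_mul_norm_iteratedFDeriv_fourier_le (K := 0) (N := N) (by exact_mod_cast hb)
        (fun k m _ hm => Continuous.integrable_of_hasCompactSupport
          ((continuous_norm.pow k).mul
            (hb.continuous_iteratedFDeriv (by exact_mod_cast hm)).norm)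
          ((hbc.iteratedFDeriv m).norm.mul_left)) le_rfl (by exact_mod_cast hn)⟩
    refine ⟨D, fun x => ?_⟩
    have := hD (-x)
    rwa [norm_neg, norm_iteratedFDeriv_zero, ← fourierInv_eq_fourier_neg] at this
  obtain ⟨D0, hD0⟩ := h1 0 (Nat.zero_le _)
  obtain ⟨D1, hD1⟩ := h1 N le_rfl
  refine ⟨2 ^ (N - 1) * (D0 + D1), fun x => ?_⟩
  have h2 := add_pow_le (zero_le_one (α := ℝ)) (norm_nonneg x) N
  have h3 := hD0 x
  have h4 := hD1 x
  calc (1 + ‖x‖) ^ N * ‖𝓕⁻ b x‖ ≤ (2 ^ (N - 1) * (1 ^ N + ‖x‖ ^ N)) * ‖𝓕⁻ b x‖ := by gcongr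
    _ = 2 ^ (N - 1) * (‖x‖ ^ 0 * ‖𝓕⁻ b x‖ + ‖x‖ ^ N * ‖𝓕⁻ b x‖) := by simp; ring
    _ ≤ _ := by gcongr

end Extension

/-! ### Cube averages, convolution bounds and growth of the measure -/

section Cubes

variable {d : ℕ}

/-- The closed cube with centre `x` and side length `2r`. -/
def centeredCube (x : EuclideanSpace ℝ (Fin d)) (r : ℝ) : Set (EuclideanSpace ℝ (Fin d)) :=
  {z | ∀ i, |z i - x i| ≤ r}

theorem mem_centeredCube_comm {x z : EuclideanSpace ℝ (Fin d)} {r : ℝ} :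
    z ∈ centeredCube x r ↔ x ∈ centeredCube z r := by
  simp only [centeredCube, Set.mem_ofPred_eq, abs_sub_comm]

theorem centeredCube_subset_of_mem {x y : EuclideanSpace ℝ (Fin d)} {r s : ℝ}
    (h : x ∈ centeredCube y s) : centeredCube x r ⊆ centeredCube y (r + s) := fun z hz i =>
  (abs_sub_le (z i) (x i) (y i)).trans (add_le_add (hz i) (h i))

theorem centeredCube_mono (x : EuclideanSpace ℝ (Fin d)) {r s : ℝ} (h : r ≤ s) :
    centeredCube x r ⊆ centeredCube x s := fun _ hz i => (hz i).trans h

theorem centeredCube_eq_cube (x : EuclideanSpace ℝ (Fin d)) (r : ℝ) :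
    centeredCube x r = cube (x - WithLp.toLp 2 (fun _ => r)) (2 * r) := by
  ext z
  simp only [centeredCube, cube, Set.mem_ofPred_eq, abs_le, Set.mem_Icc, PiLp.sub_apply]
  refine forall_congr' fun i => ?_
  constructor <;> rintro ⟨h1, h2⟩ <;> constructor <;> linarith

theorem isClosed_setOf_mem_centeredCube (r : ℝ) :
    IsClosed {q : EuclideanSpace ℝ (Fin d) × EuclideanSpace ℝ (Fin d) |
      q.2 ∈ centeredCube q.1 r} := by
  have h : {q : EuclideanSpace ℝ (Fin d) × EuclideanSpace ℝ (Fin d) |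
      q.2 ∈ centeredCube q.1 r} = ⋂ i, {q | |q.2 i - q.1 i| ≤ r} := by
    ext q
    simp [centeredCube]
  rw [h]
  exact isClosed_iInter fun i => isClosed_le
    (f := fun q : EuclideanSpace ℝ (Fin d) × EuclideanSpace ℝ (Fin d) => |q.2 i - q.1 i|)
    (by fun_prop) continuous_const

theorem isClosed_centeredCube (x : EuclideanSpace ℝ (Fin d)) (r : ℝ) :
    IsClosed (centeredCube x r) :=
  (isClosed_setOf_mem_centeredCube r).preimage (Continuous.prodMk_right x)

theorem volume_cube (a : EuclideanSpace ℝ (Fin d)) {l : ℝ} :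
    volume (cube a l) = ENNReal.ofReal l ^ d := by
  have h : cube a l = (WithLp.ofLp : EuclideanSpace ℝ (Fin d) → Fin d → ℝ) ⁻¹'
      Set.univ.pi fun i => Set.Icc (a i) (a i + l) := by
    ext z
    simp only [cube, Set.mem_ofPred_eq, Set.mem_preimage, Set.mem_univ_pi]
  rw [h, (PiLp.volume_preserving_ofLp (Fin d)).measure_preimage
    (MeasurableSet.univ_pi fun i => measurableSet_Icc).nullMeasurableSet, volume_pi_pi]
  simp

theorem volume_centeredCube (x : EuclideanSpace ℝ (Fin d)) (r : ℝ) :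
    volume (centeredCube x r) = ENNReal.ofReal (2 * r) ^ d := by
  rw [centeredCube_eq_cube, volume_cube]

theorem volume_centeredCube_natCast_add_one (x : EuclideanSpace ℝ (Fin d)) (j : ℕ) :
    volume (centeredCube x (j + 1)) = 2 ^ d * ((j : ℝ≥0∞) + 1) ^ d := by
  rw [volume_centeredCube, ENNReal.ofReal_mul zero_le_two, mul_pow,
    ENNReal.ofReal_add (Nat.cast_nonneg j) zero_le_one]
  simp

theorem measurable_setLIntegral_centeredCube {g : EuclideanSpace ℝ (Fin d) → ℝ≥0∞}
    (hg : Measurable g) (μ : Measure (EuclideanSpace ℝ (Fin d))) [SFinite μ] (r : ℝ) :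
    Measurable fun x => ∫⁻ z in centeredCube x r, g z ∂μ := by
  have h : Measurable fun q : EuclideanSpace ℝ (Fin d) × EuclideanSpace ℝ (Fin d) =>
      {q : EuclideanSpace ℝ (Fin d) × EuclideanSpace ℝ (Fin d) |
        q.2 ∈ centeredCube q.1 r}.indicator (fun q => g q.2) q :=
    (hg.comp measurable_snd).indicator (isClosed_setOf_mem_centeredCube r).measurableSet
  convert h.lintegral_prod_right' (ν := μ) using 2 with x
  rw [← lintegral_indicator (isClosed_centeredCube x r).measurableSet]
  rfl

/-- Averaging an integral over all translates of a cube. -/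
theorem lintegral_setLIntegral_centeredCube {F : EuclideanSpace ℝ (Fin d) → ℝ≥0∞}
    (hF : Measurable F) (μ : Measure (EuclideanSpace ℝ (Fin d))) [SFinite μ] (r : ℝ) :
    ∫⁻ y, ∫⁻ x in centeredCube y r, F x ∂μ = ENNReal.ofReal (2 * r) ^ d * ∫⁻ x, F x ∂μ := by
  have h : Measurable fun q : EuclideanSpace ℝ (Fin d) × EuclideanSpace ℝ (Fin d) =>
      {q : EuclideanSpace ℝ (Fin d) × EuclideanSpace ℝ (Fin d) |
        q.2 ∈ centeredCube q.1 r}.indicator (fun q => F q.2) q :=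
    (hF.comp measurable_snd).indicator (isClosed_setOf_mem_centeredCube r).measurableSet
  calc ∫⁻ y, ∫⁻ x in centeredCube y r, F x ∂μ
      = ∫⁻ y, ∫⁻ x, (centeredCube y r).indicator F x ∂μ := by
        refine lintegral_congr fun y => ?_
        rw [lintegral_indicator (isClosed_centeredCube y r).measurableSet]
    _ = ∫⁻ x, (∫⁻ y, (centeredCube y r).indicator F x) ∂μ :=
        lintegral_lintegral_swap (μ := volume) (ν := μ) (f := fun y x => (centeredCube y r).indicator F x) h.aemeasurable
    _ = ∫⁻ x, ENNReal.ofReal (2 * r) ^ d * F x ∂μ := by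
        refine lintegral_congr fun x => ?_
        have : (fun y => (centeredCube y r).indicator F x) =
            (centeredCube x r).indicator fun _ => F x := by
          ext y
          by_cases hy : x ∈ centeredCube y r
          · rw [Set.indicator_of_mem hy, Set.indicator_of_mem (mem_centeredCube_comm.1 hy)]
          · rw [Set.indicator_of_notMem hy, Set.indicator_of_notMem
              (fun h => hy (mem_centeredCube_comm.1 h))]
        rw [this, lintegral_indicator (isClosed_centeredCube x r).measurableSet,
          setLIntegral_const, volume_centeredCube, mul_comm]
    _ = _ := lintegral_const_mul _ hF

/-- The inequality characterising `A_p` weights: averages over cubes are bounded operators on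
`L^p(μ)`, uniformly in the cube. -/
def CubeAveragesBounded (q : ℝ) (μ : Measure (EuclideanSpace ℝ (Fin d))) (C : ℝ≥0∞) : Prop :=
  ∀ (a : EuclideanSpace ℝ (Fin d)) (l : ℝ), 0 < l → ∀ g : EuclideanSpace ℝ (Fin d) → ℝ≥0∞,
    Measurable g → (∫⁻ x in cube a l, g x) ^ q * μ (cube a l) ≤
      C * volume (cube a l) ^ q * ∫⁻ x in cube a l, g x ^ q ∂μ

variable {q : ℝ} {μ : Measure (EuclideanSpace ℝ (Fin d))} {C : ℝ≥0∞}

theorem CubeAveragesBounded.setLIntegral_le (h : CubeAveragesBounded q μ C)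
    (x : EuclideanSpace ℝ (Fin d)) {r : ℝ} (hr : 0 < r) {g : EuclideanSpace ℝ (Fin d) → ℝ≥0∞}
    (hg : Measurable g) : (∫⁻ z in centeredCube x r, g z) ^ q * μ (centeredCube x r) ≤
      C * volume (centeredCube x r) ^ q * ∫⁻ z in centeredCube x r, g z ^ q ∂μ := by
  rw [centeredCube_eq_cube]
  exact h _ _ (by linarith) g hg

/-- No maximal function is needed. For $x$ in the cube of half-side 1 about $y$, the cube about $x$
lies in the cube of half-side $j+1$ about $y$, where the hypothesis applies. Integration over $y$
then turns both local integrals into global ones, at the cost of a factor $(j+1)^d$. -/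
theorem CubeAveragesBounded.lintegral_le [SFinite μ] (hq : 0 ≤ q) (h : CubeAveragesBounded q μ C)
    {g : EuclideanSpace ℝ (Fin d) → ℝ≥0∞} (hg : Measurable g) (j : ℕ) :
    ∫⁻ x, (∫⁻ z in centeredCube x j, g z) ^ q ∂μ ≤
      C * (2 ^ d * ((j : ℝ≥0∞) + 1) ^ d) ^ q * ((j : ℝ≥0∞) + 1) ^ d * ∫⁻ x, g x ^ q ∂μ := by
  have hj : (0 : ℝ) < j + 1 := by positivity
  have hmono : ∀ y : EuclideanSpace ℝ (Fin d),
      ∫⁻ x in centeredCube y 1, (∫⁻ z in centeredCube x j, g z) ^ q ∂μ ≤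
        C * (2 ^ d * ((j : ℝ≥0∞) + 1) ^ d) ^ q * ∫⁻ z in centeredCube y (j + 1), g z ^ q ∂μ := by
    intro y
    calc ∫⁻ x in centeredCube y 1, (∫⁻ z in centeredCube x j, g z) ^ q ∂μ
        ≤ ∫⁻ _ in centeredCube y 1, (∫⁻ z in centeredCube y (j + 1), g z) ^ q ∂μ := by
          refine setLIntegral_mono' (isClosed_centeredCube y 1).measurableSet fun x hx => ?_
          gcongr
          exact centeredCube_subset_of_mem hx
      _ = (∫⁻ z in centeredCube y (j + 1), g z) ^ q * μ (centeredCube y 1) := setLIntegral_const _ _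
      _ ≤ (∫⁻ z in centeredCube y (j + 1), g z) ^ q * μ (centeredCube y (j + 1)) := by
          gcongr
          exact centeredCube_mono y (by linarith [Nat.cast_nonneg (α := ℝ) j])
      _ ≤ _ := by
          have := h.setLIntegral_le y hj hg
          rwa [volume_centeredCube_natCast_add_one] at this
  have h1 := lintegral_setLIntegral_centeredCube
    ((measurable_setLIntegral_centeredCube hg volume j).pow_const q) μ 1
  have h2 := lintegral_setLIntegral_centeredCube (hg.pow_const q) μ (j + 1)
  have h3 := lintegral_mono (μ := volume) hmono
  rw [h1, lintegral_const_mul _ (measurable_setLIntegral_centeredCube (hg.pow_const q) μ (j + 1)),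
    h2, ENNReal.ofReal_mul (q := (j : ℝ) + 1) zero_le_two,
    ENNReal.ofReal_add (Nat.cast_nonneg j) zero_le_one, ENNReal.ofReal_natCast] at h3
  simp only [ENNReal.ofReal_ofNat, mul_one, ENNReal.ofReal_one] at h3
  refine (ENNReal.mul_le_mul_iff_right (a := 2 ^ d) (by simp) (by simp)).1 (h3.trans_eq ?_)
  rw [mul_pow 2]
  ring

/-- The single term $j=\lceil|x|\rceil$ already dominates; the factor $2^n$ comes from
$j+1\le2(1+|x|)$. -/
theorem enorm_le_tsum_indicator_centeredCube {E : Type*} [NormedAddCommGroup E]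
    {k : EuclideanSpace ℝ (Fin d) → E} {n : ℕ} {D : ℝ}
    (hk : ∀ x, (1 + ‖x‖) ^ n * ‖k x‖ ≤ D) (x : EuclideanSpace ℝ (Fin d)) :
    ‖k x‖ₑ ≤ ∑' j : ℕ, (ENNReal.ofReal (D * 2 ^ n) * ((j : ℝ≥0∞) + 1)⁻¹ ^ n) *
      (centeredCube 0 j).indicator 1 x := by
  refine le_trans ?_ (ENNReal.le_tsum ⌈‖x‖⌉₊)
  have hx : x ∈ centeredCube 0 (⌈‖x‖⌉₊ : ℝ) := fun i => by
    simpa using (PiLp.norm_apply_le x i).trans (Nat.le_ceil _)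
  rw [Set.indicator_of_mem hx, Pi.one_apply, mul_one]
  have hj := Nat.ceil_lt_add_one (norm_nonneg x)
  set j := ⌈‖x‖⌉₊
  have e1 : ((j : ℝ≥0∞) + 1)⁻¹ ^ n = ENNReal.ofReal (((j : ℝ) + 1)⁻¹ ^ n) := by
    rw [ENNReal.ofReal_pow (by positivity), ENNReal.ofReal_inv_of_pos (by positivity),
      ENNReal.ofReal_add (by positivity) zero_le_one]
    simp
  have hD : 0 ≤ D := le_trans (by positivity) (hk x)
  rw [e1, ← ENNReal.ofReal_mul (by positivity), ← ofReal_norm]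
  refine ENNReal.ofReal_le_ofReal ?_
  rw [inv_pow, ← div_eq_mul_inv, le_div_iff₀ (by positivity)]
  calc ‖k x‖ * ((j : ℝ) + 1) ^ n ≤ ‖k x‖ * (2 * (1 + ‖x‖)) ^ n := by
        gcongr
        linarith [norm_nonneg x]
    _ = ((1 + ‖x‖) ^ n * ‖k x‖) * 2 ^ n := by rw [mul_pow]; ring
    _ ≤ D * 2 ^ n := by gcongr; exact hk x

theorem tsum_inv_natCast_add_one_sq_ne_top : ∑' j : ℕ, ((j : ℝ≥0∞) + 1)⁻¹ ^ 2 ≠ ⊤ := by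
  have h : Summable fun j : ℕ => ((j : ℝ≥0) + 1)⁻¹ ^ 2 := by
    rw [← NNReal.summable_coe]
    have := (summable_nat_add_iff 1).2 (Real.summable_nat_pow_inv.2 (one_lt_two))
    simpa using this
  convert (ENNReal.tsum_coe_ne_top_iff_summable.2 h) using 4 with j
  rw [ENNReal.coe_pow, ENNReal.coe_inv (by positivity)]
  simp

/-- A crude substitute for Minkowski's inequality: each $(j+1)^2u_j$ is at most the $\ell^q$ norm of
that weighted sequence, and the weights $(j+1)^{-2}$ are summable. -/
theorem ENNReal_tsum_rpow_le {q : ℝ} (hq : 0 < q) (u : ℕ → ℝ≥0∞) :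
    (∑' j, u j) ^ q ≤ (∑' j : ℕ, ((j : ℝ≥0∞) + 1)⁻¹ ^ 2) ^ q *
      ∑' j : ℕ, (((j : ℝ≥0∞) + 1) ^ 2 * u j) ^ q := by
  have ht (j : ℕ) : ((j : ℝ≥0∞) + 1)⁻¹ ^ 2 * ((j : ℝ≥0∞) + 1) ^ 2 = 1 := by
    rw [← mul_pow, ENNReal.inv_mul_cancel (by simp) (by simp), one_pow]
  have h1 : ∑' j, u j ≤ (∑' j : ℕ, ((j : ℝ≥0∞) + 1)⁻¹ ^ 2) *
      (∑' j : ℕ, (((j : ℝ≥0∞) + 1) ^ 2 * u j) ^ q) ^ (q⁻¹) := by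
    rw [← ENNReal.tsum_mul_right]
    refine ENNReal.tsum_le_tsum fun j => ?_
    calc u j = ((j : ℝ≥0∞) + 1)⁻¹ ^ 2 * (((j : ℝ≥0∞) + 1) ^ 2 * u j) := by
          rw [← mul_assoc, ht, one_mul]
      _ ≤ _ := by
          gcongr
          rw [ENNReal.le_rpow_inv_iff hq]
          exact ENNReal.le_tsum (f := fun j : ℕ => (((j : ℝ≥0∞) + 1) ^ 2 * u j) ^ q) j
  refine (ENNReal.rpow_le_rpow h1 hq.le).trans_eq ?_
  rw [ENNReal.mul_rpow_of_nonneg _ _ hq.le, ENNReal.rpow_inv_rpow hq.ne']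

/-- Convolution with a rapidly decreasing kernel is bounded on `L^q(μ)`. -/
theorem CubeAveragesBounded.exists_lintegral_convolution_le [SFinite μ] (hq : 1 ≤ q)
    (h : CubeAveragesBounded q μ C) (hC : C ≠ ⊤) {E : Type*} [NormedAddCommGroup E]
    {k : EuclideanSpace ℝ (Fin d) → E} {D : ℝ}
    (hk : ∀ x, (1 + ‖x‖) ^ (2 * d + 4) * ‖k x‖ ≤ D) :
    ∃ B : ℝ≥0∞, B ≠ ⊤ ∧ ∀ g : EuclideanSpace ℝ (Fin d) → ℝ≥0∞, Measurable g →
      ∫⁻ x, (∫⁻ y, ‖k (x - y)‖ₑ * g y) ^ q ∂μ ≤ B * ∫⁻ x, g x ^ q ∂μ := by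
  have hq0 : 0 < q := one_pos.trans_le hq
  set K : ℝ≥0∞ := ENNReal.ofReal (D * 2 ^ (2 * d + 4)) with hKdef
  set s : ℝ≥0∞ := ∑' j : ℕ, ((j : ℝ≥0∞) + 1)⁻¹ ^ 2 with hs
  have hs' : s ≠ ⊤ := tsum_inv_natCast_add_one_sq_ne_top
  refine ⟨s ^ q * (C * (K * 2 ^ d) ^ q * s), ?_, fun g hg => ?_⟩
  · have : K ≠ ⊤ := ENNReal.ofReal_ne_top
    finiteness
  have hpt (x : EuclideanSpace ℝ (Fin d)) : ∫⁻ y, ‖k (x - y)‖ₑ * g y ≤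
      ∑' j : ℕ, K * ((j : ℝ≥0∞) + 1)⁻¹ ^ (2 * d + 4) * ∫⁻ y in centeredCube x j, g y := by
    calc ∫⁻ y, ‖k (x - y)‖ₑ * g y
        ≤ ∫⁻ y, ∑' j : ℕ, K * ((j : ℝ≥0∞) + 1)⁻¹ ^ (2 * d + 4) *
            (centeredCube x j).indicator g y := by
          refine lintegral_mono fun y => ?_
          refine (mul_le_mul_left (enorm_le_tsum_indicator_centeredCube hk (x - y)) _).trans_eq ?_
          rw [← ENNReal.tsum_mul_right]
          refine tsum_congr fun j => ?_
          rw [mul_assoc]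
          congr 1
          have : x - y ∈ centeredCube 0 (j : ℝ) ↔ y ∈ centeredCube x (j : ℝ) := by
            simp [centeredCube, abs_sub_comm]
          by_cases hy : y ∈ centeredCube x (j : ℝ)
          · rw [Set.indicator_of_mem hy, Set.indicator_of_mem (this.2 hy), Pi.one_apply, one_mul]
          · rw [Set.indicator_of_notMem hy, Set.indicator_of_notMem (fun h => hy (this.1 h)),
              zero_mul]
      _ = _ := by
          rw [lintegral_tsum fun j : ℕ => ((hg.indicator
            (isClosed_centeredCube x j).measurableSet).const_mul _).aemeasurable]
          refine tsum_congr fun j => ?_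
          rw [lintegral_const_mul _ (hg.indicator (isClosed_centeredCube x j).measurableSet),
            lintegral_indicator (isClosed_centeredCube x j).measurableSet]
  set I := ∫⁻ x, g x ^ q ∂μ with hI
  -- This fixes the decay $2d+4$. With $t=j+1$, the summation weight costs $t^2$ and the cube volume
  -- $t^d$ inside the $q$-th power, leaving $t^{-(d+2)}$. As $q\ge1$, this still beats the outer
  -- factor $t^d$ by a summable $t^{-2}$.
  have hterm (j : ℕ) : ∫⁻ x, (((j : ℝ≥0∞) + 1) ^ 2 * (K * ((j : ℝ≥0∞) + 1)⁻¹ ^ (2 * d + 4) *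
      ∫⁻ y in centeredCube x j, g y)) ^ q ∂μ ≤
        C * (K * 2 ^ d) ^ q * ((j : ℝ≥0∞) + 1)⁻¹ ^ 2 * I := by
    set t : ℝ≥0∞ := (j : ℝ≥0∞) + 1 with ht
    have ht0 : t ≠ 0 := by simp [ht]
    have ht1 : t ≠ ⊤ := by simp [ht]
    have htt : t⁻¹ * t = 1 := ENNReal.inv_mul_cancel ht0 ht1
    have htle : t⁻¹ ≤ 1 := ENNReal.inv_le_one.2 (by simp [ht])
    calc ∫⁻ x, (t ^ 2 * (K * t⁻¹ ^ (2 * d + 4) * ∫⁻ y in centeredCube x j, g y)) ^ q ∂μ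
        = (t ^ 2 * (K * t⁻¹ ^ (2 * d + 4))) ^ q *
            ∫⁻ x, (∫⁻ y in centeredCube x j, g y) ^ q ∂μ := by
          rw [← lintegral_const_mul _
            ((measurable_setLIntegral_centeredCube hg volume j).pow_const q)]
          refine lintegral_congr fun x => ?_
          rw [← ENNReal.mul_rpow_of_nonneg _ _ hq0.le]
          ring_nf
      _ ≤ (t ^ 2 * (K * t⁻¹ ^ (2 * d + 4))) ^ q * (C * (2 ^ d * t ^ d) ^ q * t ^ d * I) := by
          gcongr
          exact h.lintegral_le hq0.le hg j
      _ = C * (K * 2 ^ d) ^ q * ((t⁻¹ ^ (d + 2)) ^ q * t ^ d) * I := by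
          have e1 : t ^ 2 * (K * t⁻¹ ^ (2 * d + 4)) * (2 ^ d * t ^ d) =
              K * 2 ^ d * t⁻¹ ^ (d + 2) := by
            calc _ = K * 2 ^ d * t⁻¹ ^ (d + 2) * (t⁻¹ * t) ^ (d + 2) := by ring_nf
              _ = _ := by rw [htt, one_pow, mul_one]
          calc _ = C * ((t ^ 2 * (K * t⁻¹ ^ (2 * d + 4))) ^ q * (2 ^ d * t ^ d) ^ q) * t ^ d * I := by
                ring
            _ = _ := by
                rw [← ENNReal.mul_rpow_of_nonneg _ _ hq0.le, e1,
                  ENNReal.mul_rpow_of_nonneg _ _ hq0.le]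
                ring
      _ ≤ C * (K * 2 ^ d) ^ q * (t⁻¹ ^ (d + 2) * t ^ d) * I := by
          gcongr
          exact ENNReal.rpow_le_self_of_le_one (pow_le_one₀ zero_le htle) hq
      _ = C * (K * 2 ^ d) ^ q * t⁻¹ ^ 2 * I := by
          have : t⁻¹ ^ (d + 2) * t ^ d = t⁻¹ ^ 2 := by
            rw [add_comm, pow_add, mul_assoc, ← mul_pow, htt, one_pow, mul_one]
          rw [this]
  calc ∫⁻ x, (∫⁻ y, ‖k (x - y)‖ₑ * g y) ^ q ∂μ
      ≤ ∫⁻ x, s ^ q * ∑' j : ℕ, (((j : ℝ≥0∞) + 1) ^ 2 * (K * ((j : ℝ≥0∞) + 1)⁻¹ ^ (2 * d + 4) *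
          ∫⁻ y in centeredCube x j, g y)) ^ q ∂μ :=
        lintegral_mono fun x =>
          (ENNReal.rpow_le_rpow (hpt x) hq0.le).trans (ENNReal_tsum_rpow_le hq0 _)
    _ = s ^ q * ∑' j : ℕ, ∫⁻ x, (((j : ℝ≥0∞) + 1) ^ 2 * (K * ((j : ℝ≥0∞) + 1)⁻¹ ^ (2 * d + 4) *
          ∫⁻ y in centeredCube x j, g y)) ^ q ∂μ := by
        have hm (j : ℕ) : Measurable fun x : EuclideanSpace ℝ (Fin d) =>
            (((j : ℝ≥0∞) + 1) ^ 2 * (K * ((j : ℝ≥0∞) + 1)⁻¹ ^ (2 * d + 4) *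
              ∫⁻ y in centeredCube x j, g y)) ^ q :=
          (((measurable_setLIntegral_centeredCube hg volume j).const_mul _).const_mul _).pow_const q
        rw [lintegral_const_mul _ (Measurable.tsum hm),
          lintegral_tsum fun j => (hm j).aemeasurable]
    _ ≤ s ^ q * ∑' j : ℕ, C * (K * 2 ^ d) ^ q * ((j : ℝ≥0∞) + 1)⁻¹ ^ 2 * I := by
        gcongr with j
        exact hterm j
    _ = _ := by
        rw [ENNReal.tsum_mul_right, ENNReal.tsum_mul_left]
        ring

/-- Testing the averaging inequality on the indicator of a fixed cube bounds the measure of large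
concentric cubes polynomially. This is what places Schwartz functions in $L^p_w$. -/
theorem CubeAveragesBounded.hasTemperateGrowth (hq : 0 < q) (h : CubeAveragesBounded q μ C)
    (hC : C ≠ ⊤) (hfin : μ (centeredCube 0 1) ≠ ⊤) : μ.HasTemperateGrowth := by
  set P := ⌈q⌉₊
  set n := d * P + 2 with hn
  have hgrow (j : ℕ) : μ (centeredCube 0 j) ≤
      C * μ (centeredCube 0 1) * ((j : ℝ≥0∞) + 1) ^ (d * P) := by
    have hm1 := (isClosed_centeredCube (0 : EuclideanSpace ℝ (Fin d)) 1).measurableSet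
    have hj0 : (0 : ℝ) ≤ j := Nat.cast_nonneg j
    have hsub : centeredCube (0 : EuclideanSpace ℝ (Fin d)) 1 ⊆ centeredCube 0 (j + 1) :=
      centeredCube_mono 0 (by linarith)
    have h1 := h.setLIntegral_le 0 (r := j + 1) (by positivity)
      (measurable_one.indicator hm1)
    have h2 : ∫⁻ z in centeredCube (0 : EuclideanSpace ℝ (Fin d)) (j + 1),
        (centeredCube 0 1).indicator 1 z = 2 ^ d := by
      rw [lintegral_indicator_one hm1, Measure.restrict_apply hm1,
        Set.inter_eq_left.2 hsub, volume_centeredCube]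
      simp
    have h3 : ∫⁻ z in centeredCube (0 : EuclideanSpace ℝ (Fin d)) (j + 1),
        ((centeredCube 0 1).indicator 1 z) ^ q ∂μ ≤ μ (centeredCube 0 1) := by
      calc _ ≤ ∫⁻ z, ((centeredCube (0 : EuclideanSpace ℝ (Fin d)) 1).indicator 1 z) ^ q ∂μ :=
            setLIntegral_le_lintegral _ _
        _ ≤ ∫⁻ z, (centeredCube (0 : EuclideanSpace ℝ (Fin d)) 1).indicator 1 z ∂μ := by
            refine lintegral_mono fun z => ?_
            by_cases hz : z ∈ centeredCube (0 : EuclideanSpace ℝ (Fin d)) 1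
            · simp [hz]
            · simp [hz, hq]
        _ = _ := lintegral_indicator_one hm1
    rw [h2, volume_centeredCube_natCast_add_one] at h1
    have h4 : (2 ^ d : ℝ≥0∞) ^ q * μ (centeredCube 0 (j + 1)) ≤
        (2 ^ d : ℝ≥0∞) ^ q * (C * μ (centeredCube 0 1) * (((j : ℝ≥0∞) + 1) ^ d) ^ q) := by
      refine h1.trans ((mul_le_mul_right h3 _).trans_eq ?_)
      rw [ENNReal.mul_rpow_of_nonneg _ _ hq.le]
      ring
    have h5 := (ENNReal.mul_le_mul_iff_right (by simp) (by finiteness)).1 h4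
    refine (measure_mono (centeredCube_mono 0 (by linarith))).trans (h5.trans ?_)
    gcongr
    rw [pow_mul, ← ENNReal.rpow_natCast (_ ^ d)]
    exact ENNReal.rpow_le_rpow_of_exponent_le (one_le_pow₀ (by simp)) (Nat.le_ceil q)
  refine ⟨n, ?_⟩
  have hk (x : EuclideanSpace ℝ (Fin d)) : (1 + ‖x‖) ^ n * ‖(1 + ‖x‖) ^ (-(n : ℝ))‖ ≤ 1 := by
    have : 0 < 1 + ‖x‖ := by positivity
    rw [Real.rpow_neg this.le, Real.rpow_natCast, Real.norm_of_nonneg (by positivity),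
      mul_inv_cancel₀ (by positivity)]
  have hcont : Continuous fun x : EuclideanSpace ℝ (Fin d) => (1 + ‖x‖) ^ (-(n : ℝ)) :=
    (continuous_const.add continuous_norm).rpow_const fun x =>
      .inl (add_pos_of_pos_of_nonneg one_pos (norm_nonneg x)).ne'
  refine ⟨hcont.aestronglyMeasurable, ?_⟩
  set K : ℝ≥0∞ := ENNReal.ofReal (1 * 2 ^ n) with hK
  have hm (j : ℕ) := (isClosed_centeredCube (0 : EuclideanSpace ℝ (Fin d)) j).measurableSet
  calc ∫⁻ x, ‖(1 + ‖x‖) ^ (-(n : ℝ))‖ₑ ∂μ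
      ≤ ∫⁻ x, ∑' j : ℕ, (K * ((j : ℝ≥0∞) + 1)⁻¹ ^ n) *
          (centeredCube 0 j).indicator 1 x ∂μ :=
        lintegral_mono fun x => enorm_le_tsum_indicator_centeredCube hk x
    _ = ∑' j : ℕ, (K * ((j : ℝ≥0∞) + 1)⁻¹ ^ n) * μ (centeredCube 0 j) := by
        rw [lintegral_tsum fun j : ℕ => ((measurable_one.indicator (hm j)).const_mul _).aemeasurable]
        refine tsum_congr fun j => ?_
        rw [lintegral_const_mul _ (measurable_one.indicator (hm j)), lintegral_indicator_one (hm j)]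
    _ ≤ ∑' j : ℕ, K * C * μ (centeredCube 0 1) * ((j : ℝ≥0∞) + 1)⁻¹ ^ 2 := by
        refine ENNReal.tsum_le_tsum fun j => (mul_le_mul_right (hgrow j) _).trans_eq ?_
        have htt : ((j : ℝ≥0∞) + 1)⁻¹ * ((j : ℝ≥0∞) + 1) = 1 :=
          ENNReal.inv_mul_cancel (by simp) (by simp)
        calc _ = K * C * μ (centeredCube 0 1) * ((j : ℝ≥0∞) + 1)⁻¹ ^ 2 *
              (((j : ℝ≥0∞) + 1)⁻¹ * ((j : ℝ≥0∞) + 1)) ^ (d * P) := by rw [hn, mul_pow]; ring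
          _ = _ := by rw [htt, one_pow, mul_one]
    _ < ⊤ := by
        rw [ENNReal.tsum_mul_left]
        have := tsum_inv_natCast_add_one_sq_ne_top
        have : K ≠ ⊤ := ENNReal.ofReal_ne_top
        finiteness

end Cubes

/-! ### Consequences of the $A_p$ condition -/

section Weights

variable {d : ℕ}

theorem measurableSet_cube (a : EuclideanSpace ℝ (Fin d)) (l : ℝ) : MeasurableSet (cube a l) := by
  have h : cube a l = centeredCube (a + WithLp.toLp 2 (fun _ => l / 2)) (l / 2) := by
    rw [centeredCube_eq_cube]
    simp [mul_div_cancel₀]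
  rw [h]
  exact (isClosed_centeredCube _ _).measurableSet

theorem volume_cube_ne_zero (a : EuclideanSpace ℝ (Fin d)) {l : ℝ} (hl : 0 < l) :
    volume (cube a l) ≠ 0 := by
  rw [volume_cube]
  exact pow_ne_zero _ (by simpa using hl)

theorem volume_cube_ne_top (a : EuclideanSpace ℝ (Fin d)) (l : ℝ) : volume (cube a l) ≠ ⊤ := by
  rw [volume_cube]
  finiteness

variable {w : EuclideanSpace ℝ (Fin d) → ℝ} {p : ℝ≥0∞}

theorem weightMeasure_cube (w : EuclideanSpace ℝ (Fin d) → ℝ) (a : EuclideanSpace ℝ (Fin d))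
    (l : ℝ) : weightMeasure w (cube a l) = ∫⁻ x in cube a l, ENNReal.ofReal (w x) :=
  withDensity_apply _ (measurableSet_cube a l)

theorem setLIntegral_weightMeasure (hw : AEMeasurable w) (a : EuclideanSpace ℝ (Fin d)) (l : ℝ)
    {g : EuclideanSpace ℝ (Fin d) → ℝ≥0∞} (hg : Measurable g) :
    ∫⁻ x in cube a l, g x ∂(weightMeasure w) =
      ∫⁻ x in cube a l, ENNReal.ofReal (w x) * g x := by
  rw [weightMeasure, restrict_withDensity (measurableSet_cube a l),
    lintegral_withDensity_eq_lintegral_mul₀ hw.ennreal_ofReal.restrict hg.aemeasurable]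
  rfl

theorem weightMeasure_absolutelyContinuous (w : EuclideanSpace ℝ (Fin d) → ℝ) :
    weightMeasure w ≪ volume :=
  withDensity_absolutelyContinuous _ _

theorem IsMuckenhoupt.absolutelyContinuous (hw : IsMuckenhoupt p w) :
    volume ≪ weightMeasure w :=
  withDensity_absolutelyContinuous' hw.aemeasurable.ennreal_ofReal
    (hw.pos.mono fun x hx => by simpa using hx)

/-- Ensures that a nonzero Schwartz function is a nonzero element of $L^p_w$, as the lower spectral
inclusion requires. -/
theorem IsMuckenhoupt.isOpenPosMeasure (hw : IsMuckenhoupt p w) :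
    (weightMeasure w).IsOpenPosMeasure :=
  hw.absolutelyContinuous.isOpenPosMeasure

/-- For $p=1$ the essential infimum is below some finite value of $w$. For $p>1$ an infinite average
of $w$ would force the dual average to vanish, but $w^{-1/(p-1)}>0$ almost everywhere. -/
theorem IsMuckenhoupt.weightMeasure_cube_ne_top (hp1 : 1 ≤ p) (hpt : p ≠ ⊤) (hw : IsMuckenhoupt p w)
    (a : EuclideanSpace ℝ (Fin d)) {l : ℝ} (hl : 0 < l) : weightMeasure w (cube a l) ≠ ⊤ := by
  have hv0 := volume_cube_ne_zero a hl
  have hvt := volume_cube_ne_top a l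
  have hne : (volume.restrict (cube a l)) ≠ 0 := by
    rw [Ne, Measure.restrict_eq_zero]
    exact hv0
  have : (ae (volume.restrict (cube a l))).NeBot := ae_neBot.2 hne
  suffices h : cubeAverage (cube a l) (fun x => ENNReal.ofReal (w x)) ≠ ⊤ by
    rw [weightMeasure_cube, ← ENNReal.div_mul_cancel hv0 hvt (b := ∫⁻ x in cube a l, _)]
    exact ENNReal.mul_ne_top h hvt
  rcases hp1.eq_or_lt with rfl | hp
  · obtain ⟨C, hC⟩ := hw.bound_of_eq_one rfl
    refine ((hC a l hl).trans_lt (ENNReal.mul_lt_top ENNReal.coe_lt_top ?_)).ne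
    obtain ⟨x, hx⟩ := (ae_essInf_le (μ := volume.restrict (cube a l))
      (f := fun x => ENNReal.ofReal (w x))).exists
    exact hx.trans_lt ENNReal.ofReal_lt_top
  · obtain ⟨C, hC⟩ := hw.bound_of_one_lt hp
    refine (ENNReal.lt_top_of_mul_ne_top_left
      ((hC a l hl).trans_lt ENNReal.coe_lt_top).ne fun h0 => ?_).ne
    rw [ENNReal.rpow_eq_zero_iff] at h0
    rcases h0 with ⟨h0, -⟩ | ⟨-, h0⟩
    · rw [cubeAverage, ENNReal.div_eq_zero_iff] at h0
      replace h0 := h0.resolve_right hvt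
      rw [lintegral_eq_zero_iff' (hw.aemeasurable.ennreal_ofReal.pow_const _).restrict] at h0
      obtain ⟨x, hx, hx'⟩ := (h0.and (ae_restrict_of_ae hw.pos)).exists
      have := ENNReal.rpow_pos (p := -1 / (p.toReal - 1)) (ENNReal.ofReal_pos.2 hx')
        ENNReal.ofReal_ne_top
      exact this.ne' hx
    · have := (ENNReal.toReal_lt_toReal ENNReal.one_ne_top hpt).2 hp
      rw [ENNReal.toReal_one] at this
      linarith

/-- For $p>1$, Hölder's inequality applied to $g=(w^{1/p}g)\,w^{-1/p}$ produces exactly the dual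
factor of the $A_p$ condition. For $p=1$, $w$ is bounded below on the cube by its essential infimum.
-/
theorem IsMuckenhoupt.cubeAveragesBounded (hp1 : 1 ≤ p) (hpt : p ≠ ⊤) (hw : IsMuckenhoupt p w) :
    ∃ C : ℝ≥0, CubeAveragesBounded p.toReal (weightMeasure w) C := by
  rcases hp1.eq_or_lt with rfl | hp
  · obtain ⟨C, hC⟩ := hw.bound_of_eq_one rfl
    refine ⟨C, fun a l hl g hg => ?_⟩
    have hv0 := volume_cube_ne_zero a hl
    have hvt := volume_cube_ne_top a l
    simp only [ENNReal.toReal_one, ENNReal.rpow_one]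
    have h1 := hC a l hl
    set m := essInf (fun x => ENNReal.ofReal (w x)) (volume.restrict (cube a l))
    rw [cubeAverage, ENNReal.div_le_iff hv0 hvt] at h1
    have h2 : m * ∫⁻ x in cube a l, g x ≤ ∫⁻ x in cube a l, ENNReal.ofReal (w x) * g x := by
      rw [← lintegral_const_mul _ hg]
      refine lintegral_mono_ae ?_
      filter_upwards [ae_essInf_le (μ := volume.restrict (cube a l))
        (f := fun x => ENNReal.ofReal (w x))] with x hx
      gcongr
    rw [setLIntegral_weightMeasure hw.aemeasurable a l hg, weightMeasure_cube]
    calc (∫⁻ x in cube a l, g x) * ∫⁻ x in cube a l, ENNReal.ofReal (w x)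
        ≤ (∫⁻ x in cube a l, g x) * (C * m * volume (cube a l)) := by gcongr
      _ = C * volume (cube a l) * (m * ∫⁻ x in cube a l, g x) := by ring
      _ ≤ _ := by gcongr
  · obtain ⟨C, hC⟩ := hw.bound_of_one_lt hp
    refine ⟨C, fun a l hl g hg => ?_⟩
    have hv0 := volume_cube_ne_zero a hl
    have hvt := volume_cube_ne_top a l
    set r := p.toReal
    have hr : 1 < r := by
      rw [← ENNReal.toReal_one]
      exact (ENNReal.toReal_lt_toReal ENNReal.one_ne_top hpt).2 hp
    have hr0 : 0 < r := one_pos.trans hr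
    have hr1 : 0 < r - 1 := sub_pos.2 hr
    set W : EuclideanSpace ℝ (Fin d) → ℝ≥0∞ := fun x => ENNReal.ofReal (w x) with hW
    have hWm : AEMeasurable W (volume.restrict (cube a l)) := hw.aemeasurable.ennreal_ofReal.restrict
    set A := ∫⁻ x in cube a l, W x
    set S := ∫⁻ x in cube a l, W x ^ (-1 / (r - 1))
    set v := volume (cube a l)
    have hAS : A * S ^ (r - 1) ≤ C * v ^ r := by
      have h1 : A / v * (S / v) ^ (r - 1) ≤ C := hC a l hl
      have e1 : v ^ r = v * v ^ (r - 1) := by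
        conv_rhs => rw [← ENNReal.rpow_one v, ← ENNReal.rpow_mul, one_mul,
          ← ENNReal.rpow_add _ _ hv0 hvt, add_sub_cancel]
      calc A * S ^ (r - 1) = (A / v * v) * (S / v * v) ^ (r - 1) := by
            rw [ENNReal.div_mul_cancel hv0 hvt, ENNReal.div_mul_cancel hv0 hvt]
        _ = (A / v * (S / v) ^ (r - 1)) * v ^ r := by
            rw [ENNReal.mul_rpow_of_nonneg _ _ hr1.le, e1]
            ring
        _ ≤ C * v ^ r := by gcongr
    have hholder : (∫⁻ x in cube a l, g x) ^ r ≤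
        (∫⁻ x in cube a l, W x * g x ^ r) * S ^ (r - 1) := by
      have hconj := Real.HolderConjugate.conjExponent hr
      have h1 := ENNReal.lintegral_mul_le_Lp_mul_Lq (volume.restrict (cube a l)) hconj
        (f := fun x => W x ^ (1 / r) * g x) (g := fun x => W x ^ (-1 / r))
        ((hWm.pow_const _).mul hg.aemeasurable) (hWm.pow_const _)
      have e1 : ∫⁻ x in cube a l, ((fun x => W x ^ (1 / r) * g x) * fun x => W x ^ (-1 / r)) x =
          ∫⁻ x in cube a l, g x := by
        refine lintegral_congr_ae ?_
        filter_upwards [ae_restrict_of_ae hw.pos] with x hx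
        have hx0 : W x ≠ 0 := by simpa [hW] using hx
        have hxt : W x ≠ ⊤ := ENNReal.ofReal_ne_top
        rw [Pi.mul_apply, mul_right_comm, ← ENNReal.rpow_add _ _ hx0 hxt]
        rw [show 1 / r + -1 / r = 0 by ring, ENNReal.rpow_zero, one_mul]
      have e2 : ∫⁻ x in cube a l, (W x ^ (1 / r) * g x) ^ r =
          ∫⁻ x in cube a l, W x * g x ^ r := by
        refine lintegral_congr fun x => ?_
        rw [ENNReal.mul_rpow_of_nonneg _ _ hr0.le, ← ENNReal.rpow_mul,
          one_div_mul_cancel hr0.ne', ENNReal.rpow_one]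
      have e3 : ∫⁻ x in cube a l, (W x ^ (-1 / r)) ^ r.conjExponent = S := by
        refine lintegral_congr fun x => ?_
        rw [← ENNReal.rpow_mul, Real.conjExponent]
        congr 1
        field_simp
      rw [e1, e2, e3] at h1
      refine (ENNReal.rpow_le_rpow h1 hr0.le).trans_eq ?_
      rw [ENNReal.mul_rpow_of_nonneg _ _ hr0.le, ← ENNReal.rpow_mul, ← ENNReal.rpow_mul,
        one_div_mul_cancel hr0.ne', ENNReal.rpow_one, Real.conjExponent]
      congr 2
      field_simp
    rw [setLIntegral_weightMeasure hw.aemeasurable a l (hg.pow_const r), weightMeasure_cube]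
    calc (∫⁻ x in cube a l, g x) ^ r * A
        ≤ ((∫⁻ x in cube a l, W x * g x ^ r) * S ^ (r - 1)) * A := by gcongr
      _ = (A * S ^ (r - 1)) * ∫⁻ x in cube a l, W x * g x ^ r := by ring
      _ ≤ _ := by gcongr

theorem IsMuckenhoupt.weightMeasure_centeredCube_ne_top (hp1 : 1 ≤ p) (hpt : p ≠ ⊤) (hw : IsMuckenhoupt p w)
    (x : EuclideanSpace ℝ (Fin d)) {r : ℝ} (hr : 0 < r) :
    weightMeasure w (centeredCube x r) ≠ ⊤ := by
  rw [centeredCube_eq_cube]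
  exact hw.weightMeasure_cube_ne_top hp1 hpt _ (by linarith)

theorem IsMuckenhoupt.isFiniteMeasureOnCompacts (hp1 : 1 ≤ p) (hpt : p ≠ ⊤)
    (hw : IsMuckenhoupt p w) :
    IsFiniteMeasureOnCompacts (weightMeasure w) := by
  refine ⟨fun K hK => ?_⟩
  obtain ⟨R, hR⟩ := hK.isBounded.subset_closedBall 0
  refine lt_of_le_of_lt (measure_mono (show K ⊆ centeredCube 0 (max R 1) from ?_))
    (hw.weightMeasure_centeredCube_ne_top hp1 hpt 0 (r := max R 1) (by positivity)).lt_top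
  intro x hx i
  have h1 := hR hx
  rw [mem_closedBall_zero_iff] at h1
  simpa using ((PiLp.norm_apply_le x i).trans h1).trans (le_max_left R 1)

theorem IsMuckenhoupt.hasTemperateGrowth (hp1 : 1 ≤ p) (hpt : p ≠ ⊤) (hw : IsMuckenhoupt p w) :
    (weightMeasure w).HasTemperateGrowth := by
  obtain ⟨C, hC⟩ := hw.cubeAveragesBounded hp1 hpt
  exact hC.hasTemperateGrowth (ENNReal.toReal_pos (zero_lt_one.trans_le hp1).ne' hpt)
    ENNReal.coe_ne_top (hw.weightMeasure_centeredCube_ne_top hp1 hpt 0 one_pos)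

theorem CubeAveragesBounded.hasSmoothMultipliers {μ : Measure (EuclideanSpace ℝ (Fin d))}
    [μ.HasTemperateGrowth] [IsFiniteMeasureOnCompacts μ] [Fact (1 ≤ p)] (hpt : p ≠ ⊤) {C : ℝ≥0}
    (h : CubeAveragesBounded p.toReal μ C) : HasSmoothMultipliers p μ (2 * d + 4) := by
  intro b hb hbc
  have hp1 : 1 ≤ p := Fact.out
  have hp0 : p ≠ 0 := (zero_lt_one.trans_le hp1).ne'
  have hr : 1 ≤ p.toReal := by
    rw [← ENNReal.toReal_one]
    exact (ENNReal.toReal_le_toReal ENNReal.one_ne_top hpt).2 hp1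
  obtain ⟨M, hM⟩ := hbc.exists_bound_of_continuous hb.continuous
  obtain ⟨D, hD⟩ := exists_pow_mul_norm_fourierInv_le hb hbc
  obtain ⟨B, hB, hconv⟩ := h.exists_lintegral_convolution_le hr ENNReal.coe_ne_top hD
  refine exists_isMultiplier_of_bound hpt hb.continuous hM
    (C := (B ^ (1 / p.toReal)).toNNReal) fun f => ?_
  rw [ENNReal.coe_toNNReal (by finiteness), eLpNorm_eq_lintegral_rpow_enorm_toReal hp0 hpt,
    eLpNorm_eq_lintegral_rpow_enorm_toReal hp0 hpt,
    ← ENNReal.mul_rpow_of_nonneg _ _ (by positivity)]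
  refine ENNReal.rpow_le_rpow (le_trans (lintegral_mono fun x => ?_)
    (hconv (fun y => ‖f y‖ₑ) f.continuous.measurable.enorm)) (by positivity)
  exact ENNReal.rpow_le_rpow (enorm_fourierInv_mul_fourier_le
    (hb.continuous.integrable_of_hasCompactSupport hbc) f.integrable x) (by positivity)

end Weights

/-! ### Regularity and values of the Bochner–Riesz symbol -/

section BochnerRiesz

theorem hasDerivAt_max_zero_rpow {s : ℝ} (hs : 1 < s) (t : ℝ) :
    HasDerivAt (fun t : ℝ => max t 0 ^ s) (s * max t 0 ^ (s - 1)) t := by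
  rcases lt_trichotomy t 0 with ht | rfl | ht
  · rw [max_eq_right ht.le, zero_rpow (by linarith), mul_zero]
    refine (hasDerivAt_const t (0 : ℝ)).congr_of_eventuallyEq ?_
    filter_upwards [eventually_lt_nhds ht] with x hx
    rw [max_eq_right hx.le, zero_rpow (by linarith)]
  -- At the origin the truncated power is dominated by $|t^s|$, which is $o(t)$ because $s>1$.
  · rw [max_self, zero_rpow (by linarith), mul_zero, hasDerivAt_iff_isLittleO_nhds_zero]
    have h := (hasDerivAt_iff_isLittleO_nhds_zero.1
      (Real.hasDerivAt_rpow_const (x := 0) (p := s) (.inr hs.le)))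
    simp only [zero_add, zero_rpow (show s ≠ 0 by linarith), zero_rpow (show s - 1 ≠ 0 by linarith),
      mul_zero, smul_zero, sub_zero, max_self] at h ⊢
    refine (Asymptotics.IsBigO.of_bound 1 (.of_forall fun x => ?_)).trans_isLittleO h.norm_left
    rcases le_total 0 x with hx | hx
    · simp [max_eq_left hx]
    · simp [max_eq_right hx, zero_rpow (show s ≠ 0 by linarith)]
  · rw [max_eq_left ht.le]
    refine (Real.hasDerivAt_rpow_const (.inl ht.ne')).congr_of_eventuallyEq ?_
    filter_upwards [eventually_gt_nhds ht] with x hx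
    rw [max_eq_left hx.le]

theorem contDiff_max_zero_rpow (n : ℕ) {s : ℝ} (hs : n < s) :
    ContDiff ℝ n fun t : ℝ => max t 0 ^ s := by
  induction n generalizing s with
  | zero =>
    rw [Nat.cast_zero] at hs
    exact contDiff_zero.2 ((continuous_id.max continuous_const).rpow_const fun _ => .inr hs.le)
  | succ n ih =>
    push_cast at hs ⊢
    have hs1 : 1 < s := by linarith [Nat.cast_nonneg (α := ℝ) n]
    rw [contDiff_succ_iff_deriv]
    refine ⟨fun t => (hasDerivAt_max_zero_rpow hs1 t).differentiableAt, by simp, ?_⟩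
    rw [show deriv (fun t : ℝ => max t 0 ^ s) = fun t => s * max t 0 ^ (s - 1) from
      funext fun t => (hasDerivAt_max_zero_rpow hs1 t).deriv]
    exact contDiff_const.mul (ih (by linarith))

variable {d : ℕ} {δ : ℝ}

/-- The symbol of `B_δ` for Mathlib's normalisation of the Fourier transform. -/
noncomputable def rescaledSymbol (δ : ℝ) (ξ : EuclideanSpace ℝ (Fin d)) : ℝ :=
  bochnerRieszSymbol δ ((2 * π) • ξ)

theorem continuous_rescaledSymbol (hδ : 0 < δ) :
    Continuous (rescaledSymbol (d := d) δ) := by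
  unfold rescaledSymbol bochnerRieszSymbol
  exact Continuous.rpow_const (by fun_prop) fun _ => .inr hδ.le

/-- The true support radius is $1/(2\pi)$; the cruder radius 1 is enough for compactness. -/
theorem rescaledSymbol_eq_zero (hδ : 0 < δ) {ξ : EuclideanSpace ℝ (Fin d)} (hξ : 1 ≤ ‖ξ‖) :
    rescaledSymbol δ ξ = 0 := by
  have h1 : 1 ≤ ‖(2 * π) • ξ‖ := by
    rw [norm_smul, Real.norm_of_nonneg (by positivity)]
    nlinarith [Real.pi_gt_three]
  rw [rescaledSymbol, bochnerRieszSymbol, max_eq_right (by nlinarith), zero_rpow hδ.ne']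

theorem hasCompactSupport_rescaledSymbol (hδ : 0 < δ) :
    HasCompactSupport (rescaledSymbol (d := d) δ) := by
  refine HasCompactSupport.intro (isCompact_closedBall 0 1) fun ξ hξ => ?_
  rw [mem_closedBall_zero_iff, not_le] at hξ
  exact rescaledSymbol_eq_zero hδ hξ.le

theorem rescaledSymbol_mem_Icc (hδ : 0 < δ) (ξ : EuclideanSpace ℝ (Fin d)) :
    rescaledSymbol δ ξ ∈ Set.Icc (0 : ℝ) 1 :=
  ⟨rpow_nonneg (le_max_right _ _) _, rpow_le_one (le_max_right _ _)
    (max_le (by nlinarith [norm_nonneg ((2 * π) • ξ)]) zero_le_one) hδ.le⟩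

theorem contDiff_rescaledSymbol_pow (N : ℕ) {k : ℕ} (hk : N < δ * k) :
    ContDiff ℝ N (rescaledSymbol (d := d) δ ^ k) := by
  have h : rescaledSymbol (d := d) δ ^ k = (fun t : ℝ => max t 0 ^ (δ * k)) ∘
      fun ξ : EuclideanSpace ℝ (Fin d) => 1 - ‖(2 * π) • ξ‖ ^ 2 := by
    ext ξ
    simp only [Pi.pow_apply, rescaledSymbol, bochnerRieszSymbol, Function.comp_apply]
    rw [rpow_mul (le_max_right _ _), rpow_natCast]
  rw [h]
  exact (contDiff_max_zero_rpow N hk).comp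
    (contDiff_const.sub ((contDiff_const_smul _).norm_sq ℝ))

/-- Solving $(1-\rho^2)^\delta=t$ gives a point inside the open ball where the base of the power is
positive, so the symbol is smooth nearby. -/
theorem exists_rescaledSymbol_eq (hd : 1 ≤ d) (hδ : 0 < δ) {t : ℝ} (ht : t ∈ Set.Ioo (0 : ℝ) 1) :
    ∃ ξ : EuclideanSpace ℝ (Fin d), rescaledSymbol δ ξ = t ∧
      ∃ s > 0, ContDiffOn ℝ ∞ (rescaledSymbol δ) (Metric.ball ξ s) := by
  have hu0 : 0 < t ^ (1 / δ) := rpow_pos_of_pos ht.1 _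
  have hu1 : t ^ (1 / δ) < 1 := rpow_lt_one ht.1.le ht.2 (by positivity)
  set ρ := √(1 - t ^ (1 / δ)) with hρ
  have hρ2 : ρ ^ 2 = 1 - t ^ (1 / δ) := Real.sq_sqrt (by linarith)
  let e : EuclideanSpace ℝ (Fin d) := EuclideanSpace.single ⟨0, hd⟩ 1
  have he : ‖e‖ = 1 := by simp [e]
  let ξ : EuclideanSpace ℝ (Fin d) := (ρ / (2 * π)) • e
  have hξ : ‖(2 * π) • ξ‖ ^ 2 = ρ ^ 2 := by
    rw [smul_smul, mul_div_cancel₀ _ (by positivity), norm_smul, he, mul_one, Real.norm_eq_abs,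
      sq_abs]
  refine ⟨ξ, ?_, ?_⟩
  · rw [rescaledSymbol, bochnerRieszSymbol, hξ, hρ2, sub_sub_cancel, max_eq_left hu0.le,
      ← rpow_mul ht.1.le, one_div_mul_cancel hδ.ne', rpow_one]
  · have hcont : Continuous fun η : EuclideanSpace ℝ (Fin d) => 1 - ‖(2 * π) • η‖ ^ 2 := by
      fun_prop
    have hopen : IsOpen {η : EuclideanSpace ℝ (Fin d) | 0 < 1 - ‖(2 * π) • η‖ ^ 2} :=
      isOpen_lt continuous_const hcont
    obtain ⟨s, hs, hsub⟩ := Metric.isOpen_iff.1 hopen ξ (by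
      change 0 < 1 - ‖(2 * π) • ξ‖ ^ 2
      rw [hξ, hρ2]
      linarith)
    refine ⟨s, hs, ?_⟩
    have h1 : ContDiffOn ℝ ∞ (fun η : EuclideanSpace ℝ (Fin d) =>
        (1 - ‖(2 * π) • η‖ ^ 2) ^ δ) (Metric.ball ξ s) :=
      ContDiffOn.rpow_const_of_ne
        (contDiff_const.sub ((contDiff_const_smul _).norm_sq ℝ)).contDiffOn
        fun η hη => (hsub hη).ne'
    refine h1.congr fun η hη => ?_
    rw [rescaledSymbol, bochnerRieszSymbol, max_eq_left (hsub hη).le]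

theorem isBochnerRieszOn_iff_isMultiplier {p : ℝ≥0∞} [Fact (1 ≤ p)]
    {w : EuclideanSpace ℝ (Fin d) → ℝ} [(weightMeasure w).HasTemperateGrowth] (hδ : 0 < δ)
    (hB : BochnerRieszBounded δ p w) {T : WeightedLp p w →L[ℂ] WeightedLp p w} :
    IsBochnerRieszOn δ p w T ↔ IsMultiplier (fun ξ => (rescaledSymbol δ ξ : ℂ)) T := by
  have hcont : Continuous fun ξ : EuclideanSpace ℝ (Fin d) => (rescaledSymbol δ ξ : ℂ) :=
    Complex.continuous_ofReal.comp (continuous_rescaledSymbol hδ)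
  have hbd (ξ : EuclideanSpace ℝ (Fin d)) : ‖(rescaledSymbol δ ξ : ℂ)‖ ≤ 1 := by
    rw [Complex.norm_real, Real.norm_of_nonneg (rescaledSymbol_mem_Icc hδ ξ).1]
    exact (rescaledSymbol_mem_Icc hδ ξ).2
  constructor
  · intro h f
    obtain ⟨hf, hBf, hT⟩ := h f
    have : T (f.toLp p (weightMeasure w)) = hBf.toLp (bochnerRiesz δ f) := hT
    rw [this]
    exact hBf.coeFn_toLp
  · intro h f
    obtain ⟨C, hC⟩ := hB
    have hBf : MemLp (bochnerRiesz δ f) p (weightMeasure w) :=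
      memLp_fourierInv_mul_fourier hcont hbd f (hC f)
    exact ⟨f.memLp p _, hBf, Lp.ext ((h f).trans hBf.coeFn_toLp.symm)⟩

end BochnerRiesz

end

theorem mainTheorem7 (d : ℕ) (hd : 1 ≤ d) (δ : ℝ) (hδ : 0 < δ) (p : ℝ≥0∞) [Fact (1 ≤ p)]
    (hp : p < ∞) (w : EuclideanSpace ℝ (Fin d) → ℝ) (hw : IsMuckenhoupt p w)
    (hB : BochnerRieszBounded δ p w) :
    (∃! T : WeightedLp p w →L[ℂ] WeightedLp p w, IsBochnerRieszOn δ p w T) ∧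
      ∀ T : WeightedLp p w →L[ℂ] WeightedLp p w, IsBochnerRieszOn δ p w T →
        spectrum ℂ T = Complex.ofReal '' Set.Icc (0 : ℝ) 1 := by
  have hp1 : 1 ≤ p := Fact.out
  have hpt : p ≠ ⊤ := hp.ne
  have := hw.hasTemperateGrowth hp1 hpt
  have := hw.isFiniteMeasureOnCompacts hp1 hpt
  have := hw.isOpenPosMeasure
  have hcont := continuous_rescaledSymbol (d := d) hδ
  have hsupp := hasCompactSupport_rescaledSymbol (d := d) hδ
  obtain ⟨K, hK⟩ := hw.cubeAveragesBounded hp1 hpt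
  have hN := hK.hasSmoothMultipliers hpt
  have hac := weightMeasure_absolutelyContinuous w
  simp only [isBochnerRieszOn_iff_isMultiplier hδ hB]
  refine ⟨?_, fun T hT => Set.Subset.antisymm ?_ ?_⟩
  · obtain ⟨C, hC⟩ := hB
    obtain ⟨T, hT⟩ := exists_isMultiplier_of_bound (μ := weightMeasure w) (p := p) hpt
      (a := fun ξ => (rescaledSymbol δ ξ : ℂ)) (Complex.continuous_ofReal.comp hcont) (M := 1)
      (fun ξ => by
        rw [Complex.norm_real, Real.norm_of_nonneg (rescaledSymbol_mem_Icc hδ ξ).1]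
        exact (rescaledSymbol_mem_Icc hδ ξ).2) hC
    exact ⟨T, hT, fun S hS => hS.ext hpt hT⟩
  -- From $k_0$ on, $k\delta>2d+4$, so $a^k$ has the smoothness required of a multiplier.
  · obtain ⟨k₀, hk₀⟩ := exists_nat_gt (((2 * d + 4 : ℕ) : ℝ) / δ)
    refine hT.spectrum_subset hpt hac hN hcont hsupp (rescaledSymbol_mem_Icc hδ) (k₀ := k₀)
      fun k hk => contDiff_rescaledSymbol_pow _ ?_
    rw [div_lt_iff₀ hδ] at hk₀
    have : (k₀ : ℝ) ≤ k := by exact_mod_cast hk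
    exact hk₀.trans_le (by rw [mul_comm]; gcongr)
  · have hIoo : Complex.ofReal '' Set.Ioo (0 : ℝ) 1 ⊆ spectrum ℂ T := by
      rintro _ ⟨t, ht, rfl⟩
      obtain ⟨ξ, rfl, s, hs, hsm⟩ := exists_rescaledSymbol_eq hd hδ ht
      exact hT.mem_spectrum hpt hac hN hcont hsupp hs hsm
    -- The endpoints are reached as limits, the spectrum being closed.
    rw [← closure_Ioo zero_ne_one]
    exact (image_closure_subset_closure_image Complex.continuous_ofReal).trans
      (closure_minimal hIoo (spectrum.isClosed T))
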